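/- Let $(\omega_s)_{0\le s\le 1}$ be the standard Brownian bridge from $0$ to $0$, i.e. the centred Gaussian process with continuous paths and covariance $s(1-t)$ for $0\le s\le t\le 1$, and let $\mathbb E_0^0$ denote expectation under its law. For all real constants $\alpha$ and $\gamma$ the variable $\exp\int_0^1\big(\alpha\,\omega_s-\tfrac12\gamma^2\omega_s^2\big)ds$ is integrable and $$\mathbb E_0^0\Big[\exp\Big(\int_0^1\big(\alpha\,\omega_s-\tfrac12\gamma^2\omega_s^2\big)\,ds\Big)\Big]=\sqrt{\frac{\gamma}{\sinh\gamma}}\;\exp\Big[\frac{\alpha^2}{\gamma^3}\Big(\frac{\gamma}{2}-\tanh\frac{\gamma}{2}\Big)\Big],$$ where for $\gamma=0$ the right-hand side is understood as its limit $e^{\alpha^2/24}$. Moreover, for all real $\xi$, $\chi>-\pi^2$ and $x>0$, put $R=\sqrt{\chi^2+x^2}$, $a=\sqrt{(R+\chi)/2}$, $b=\sqrt{(R-\chi)/2}$, so that $(a+ib)^2=\chi+ix$, and $$\varphi(\chi,x)=\tfrac12\arctan\sqrt{\frac{R-\chi}{R+\chi}}-\tfrac12\int_0^{b}\frac{\sinh(2a)}{\cosh(2a)-\cos(2\beta)}\,d\beta,\qquad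 f(\chi,x)=1-\frac{\tanh\big((a+ib)/2\big)}{(a+ib)/2}.$$ Then the variable below is integrable and $$\mathbb E_0^0\Big[\exp\Big(\int_0^1\big(i\,\xi\,\omega_s-\tfrac{\chi+ix}{2}\,\omega_s^2\big)\,ds\Big)\Big]=e^{i\varphi(\chi,x)}\Big[\frac{2R}{\cosh(2a)-\cos(2b)}\Big]^{1/4}\exp\Big[-\frac{\xi^2}{2(\chi+ix)}\,f(\chi,x)\Big],$$ and $$f(\chi,x)=1-\frac{a\sinh a+b\sin b+i\,(a\sin b-b\sinh a)}{(a^2+b^2)(\cosh a+\cos b)/2}.$$ -/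

import Mathlib

open MeasureTheory ProbabilityTheory

namespace BrownianBridge

/-- A real process indexed by `[0,1]` is a standard Brownian bridge (from `0` to `0`) if it is a
centred Gaussian process with covariance `s (1 - t)` for `s ≤ t` and almost surely continuous
paths.  These conditions determine its law, the pinned Wiener measure; the endpoint values `0` at
times `0` and `1` (almost surely) are the case of variance zero.  That `P` is a probability measure
is part of `IsGaussianProcess`. -/
structure IsStandardBridge {Ω : Type*} [MeasurableSpace Ω] (X : unitInterval → Ω → ℝ)
    (P : Measure Ω) : Prop where
  isGaussianProcess : IsGaussianProcess X P
  mean_eq_zero : ∀ t, ∫ ω, X t ω ∂P = 0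
  covariance_eq : ∀ s t : unitInterval, s ≤ t → cov[X s, X t; P] = (s : ℝ) * (1 - (t : ℝ))
  continuous_paths : ∀ᵐ ω ∂P, Continuous fun t ↦ X t ω

/-- The real part `a` of the square root of `χ + i x`. -/
noncomputable def sqrtRe (χ x : ℝ) : ℝ := √((√(χ ^ 2 + x ^ 2) + χ) / 2)

/-- The imaginary part `b` of the square root of `χ + i x`, for `x ≥ 0`. -/
noncomputable def sqrtIm (χ x : ℝ) : ℝ := √((√(χ ^ 2 + x ^ 2) - χ) / 2)

/-- The square root `a + i b` of `χ + i x`, for `x ≥ 0`; see `csqrt_sq`. -/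
noncomputable def csqrt (χ x : ℝ) : ℂ := (sqrtRe χ x : ℂ) + Complex.I * (sqrtIm χ x : ℂ)

theorem csqrt_sq (χ x : ℝ) (hx : 0 ≤ x) : csqrt χ x ^ 2 = (χ : ℂ) + Complex.I * (x : ℂ) := by
  have h1 : |χ| ≤ √(χ ^ 2 + x ^ 2) := Real.abs_le_sqrt (by nlinarith [sq_nonneg x])
  have hp : 0 ≤ (√(χ ^ 2 + x ^ 2) + χ) / 2 := by linarith [neg_abs_le χ]
  have hm : 0 ≤ (√(χ ^ 2 + x ^ 2) - χ) / 2 := by linarith [le_abs_self χ]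
  have ha : sqrtRe χ x ^ 2 = (√(χ ^ 2 + x ^ 2) + χ) / 2 := Real.sq_sqrt hp
  have hb : sqrtIm χ x ^ 2 = (√(χ ^ 2 + x ^ 2) - χ) / 2 := Real.sq_sqrt hm
  have hab : 2 * (sqrtRe χ x * sqrtIm χ x) = x := by
    have hs : √(χ ^ 2 + x ^ 2) ^ 2 = χ ^ 2 + x ^ 2 := Real.sq_sqrt (by positivity)
    have : (2 * (sqrtRe χ x * sqrtIm χ x)) ^ 2 = x ^ 2 := by
      rw [mul_pow, mul_pow, ha, hb]; nlinarith
    have h0 : 0 ≤ 2 * (sqrtRe χ x * sqrtIm χ x) := by unfold sqrtRe sqrtIm; positivity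
    nlinarith [sq_nonneg (2 * (sqrtRe χ x * sqrtIm χ x) + x)]
  have hre : sqrtRe χ x ^ 2 - sqrtIm χ x ^ 2 = χ := by rw [ha, hb]; ring
  apply Complex.ext
  · simpa [csqrt, pow_two] using (by nlinarith : _ = χ)
  · simpa [csqrt, pow_two] using (by nlinarith : _ = x)

/-- The phase `φ(χ, x)` of the continuous determination of `√(√(χ + i x) / sinh √(χ + i x))`:
`½ arctan (b / a) - ½ ∫₀ᵇ sinh (2a) / (cosh (2a) - cos (2β)) dβ`, written out in `χ` and `x`. -/
noncomputable def phase (χ x : ℝ) : ℝ :=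
  (1 / 2) * Real.arctan √((√(χ ^ 2 + x ^ 2) - χ) / (√(χ ^ 2 + x ^ 2) + χ)) -
    (1 / 2) * ∫ β in (0 : ℝ)..√((√(χ ^ 2 + x ^ 2) - χ) / 2),
      Real.sinh √(2 * √(χ ^ 2 + x ^ 2) + 2 * χ) /
        (Real.cosh √(2 * √(χ ^ 2 + x ^ 2) + 2 * χ) - Real.cos (2 * β))

/-- The modulus of the same determination. -/
noncomputable def amplitude (χ x : ℝ) : ℝ :=
  (2 * √(χ ^ 2 + x ^ 2) /
    (Real.cosh √(2 * √(χ ^ 2 + x ^ 2) + 2 * χ) -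
      Real.cos √(2 * √(χ ^ 2 + x ^ 2) - 2 * χ))) ^ (1 / 4 : ℝ)

/-- `f(χ, x) = 1 - tanh (√(χ + i x) / 2) / (√(χ + i x) / 2)`. -/
noncomputable def fcoef (χ x : ℝ) : ℂ :=
  1 - Complex.tanh (csqrt χ x / 2) / (csqrt χ x / 2)

end BrownianBridge

/-! The proof is a Karhunen–Loève expansion. The covariance kernel is the Green function of
`-d²/dt²` on `[0,1]` with Dirichlet conditions, so the functions `sine n` diagonalize it with
eigenvalues `1 / freq n ^ 2`. The coefficients of the path are therefore independent centred
Gaussians with these variances (`map_sineCoeff`, `iIndepFun_sineCoeff`).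

Almost surely `∫ X²` is the sum of the squared coefficients and `∫ X` the sum of the coefficients
times `sineMean n`. Completeness of the sines is not invoked: Bessel's inequality holds pathwise,
and the expectations of its two sides match because the trace `1 / 6` of the kernel equals `∑ 1 /
freq n ^ 2`.

The truncated functional thus factors into one-dimensional Gaussian integrals (`integral_modeExp`).
The truncation is removed by dominated convergence; the dominating exponential moment of `∫ X²`,
finite below `π²`, comes from Fatou's lemma. With `ζ = z²`, the squared normalizations multiply to
the inverse of Euler's product for `sinh z / z`, and the exponents sum to the `tanh` expression
through the partial fractions of `coth`.

This determines the case `α = 0` only up to sign. For real `z` positivity decides. For `z = a + i b`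
the expectation and the explicit root `sqrtDivSinh` are continuous along the segment from `a` to `a
+ i b`, have equal squares, do not vanish, and agree at `a`, hence agree throughout
(`integral_pathExp_eq_sqrtDivSinh`). -/

namespace BrownianBridge

open Filter Topology

/-! ### Covariance kernel and discretization of time -/

/-- The covariance kernel of the standard Brownian bridge. -/
noncomputable def kernel (s t : unitInterval) : ℝ := min (s : ℝ) t * (1 - max (s : ℝ) t)

theorem continuous_kernel : Continuous fun p : unitInterval × unitInterval ↦ kernel p.1 p.2 := by
  unfold kernel; fun_prop

theorem kernel_abs_le (s t : unitInterval) : |kernel s t| ≤ 1 := by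
  have h1 := s.2.1; have h2 := s.2.2; have h3 := t.2.1; have h4 := t.2.2
  unfold kernel
  rw [abs_mul]
  refine mul_le_one₀ ?_ (abs_nonneg _) ?_
  · rw [abs_le]; constructor
    · linarith [le_min h1 h3]
    · exact (min_le_left _ _).trans h2
  · rw [abs_le]; constructor
    · linarith [max_le h2 h4]
    · linarith [le_max_left (s : ℝ) t]

/-- Simple functions that converge pointwise to the identity of the unit interval. -/
noncomputable def mesh (m : ℕ) : SimpleFunc unitInterval unitInterval :=
  SimpleFunc.nearestPt (TopologicalSpace.denseSeq unitInterval) m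

theorem tendsto_mesh (s : unitInterval) : Tendsto (fun m ↦ mesh m s) atTop (𝓝 s) :=
  SimpleFunc.tendsto_nearestPt (TopologicalSpace.denseRange_denseSeq unitInterval s)

theorem continuous_integrable {E : Type*} [NormedAddCommGroup E] {f : unitInterval → E}
    (hf : Continuous f) : Integrable f :=
  hf.integrable_of_hasCompactSupport (HasCompactSupport.of_compactSpace f)

/-- The integral of a simple reparametrization is a finite sum. -/
theorem integral_simpleFunc_comp_mul (p : SimpleFunc unitInterval unitInterval)
    (g : unitInterval → ℝ) {h : unitInterval → ℝ} (hh : Integrable h) :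
    ∫ s, h s * g (p s) = ∑ y ∈ p.range, (∫ s in p ⁻¹' {y}, h s) * g y := by
  have : ∀ s, h s * g (p s) = ∑ y ∈ p.range, (p ⁻¹' {y}).indicator h s * g y := by
    intro s
    rw [Finset.sum_eq_single (p s)]
    · simp
    · intro y _ hy
      rw [Set.indicator_of_notMem (by simpa using hy.symm), zero_mul]
    · intro hs; simp at hs
  simp_rw [this]
  rw [integral_finsetSum]
  · refine Finset.sum_congr rfl fun y _ ↦ ?_
    rw [integral_mul_const, integral_indicator (p.measurableSet_fiber y)]
  · intro y _
    exact (hh.indicator (p.measurableSet_fiber y)).mul_const _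

theorem measurable_simpleFunc_comp (p : SimpleFunc unitInterval unitInterval)
    {E : Type*} [MeasurableSpace E] (g : unitInterval → E) : Measurable fun s ↦ g (p s) :=
  (p.map g).measurable

/-- Discretization turns path integrals into limits of finite combinations of values of the path;
measurability and Gaussian computations both pass through it. -/
theorem tendsto_integral_mesh {g h : unitInterval → ℝ} (hg : Continuous g) (hh : Continuous h) :
    Tendsto (fun m ↦ ∫ s, h s * g (mesh m s)) atTop (𝓝 (∫ s, h s * g s)) := by
  obtain ⟨C, hC⟩ := isCompact_univ.exists_bound_of_continuousOn hg.continuousOn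
  refine tendsto_integral_of_dominated_convergence (fun s ↦ |h s| * C) ?_ ?_ ?_ ?_
  · intro m
    exact (hh.measurable.mul (measurable_simpleFunc_comp _ g)).aestronglyMeasurable
  · exact (continuous_integrable (by fun_prop))
  · intro m
    refine ae_of_all _ fun s ↦ ?_
    rw [norm_mul]
    exact mul_le_mul_of_nonneg_left (hC _ trivial) (abs_nonneg _)
  · refine ae_of_all _ fun s ↦ ?_
    exact ((hg.tendsto s).comp (tendsto_mesh s)).const_mul _

/-- The quadratic form of the covariance kernel. -/
noncomputable def covForm (h : unitInterval → ℝ) : ℝ := ∫ s, h s * ∫ t, h t * kernel s t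

theorem tendsto_covForm_mesh {h : unitInterval → ℝ} (hh : Continuous h) :
    Tendsto (fun m ↦ ∫ s, h s * ∫ t, h t * kernel (mesh m s) (mesh m t)) atTop
      (𝓝 (covForm h)) := by
  have hb : ∀ (m : ℕ) (s t : unitInterval), ‖h t * kernel (mesh m s) (mesh m t)‖ ≤ |h t| := by
    intro m s t
    rw [norm_mul]
    exact mul_le_of_le_one_right (abs_nonneg _) (kernel_abs_le _ _)
  refine tendsto_integral_of_dominated_convergence (fun s ↦ |h s| * ∫ t, |h t|) ?_ ?_ ?_ ?_
  · intro m
    exact (hh.measurable.mul (measurable_simpleFunc_comp (mesh m)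
      fun y ↦ ∫ t, h t * kernel y (mesh m t))).aestronglyMeasurable
  · exact (continuous_integrable (by fun_prop))
  · intro m
    refine ae_of_all _ fun s ↦ ?_
    rw [norm_mul]
    refine mul_le_mul_of_nonneg_left ?_ (abs_nonneg _)
    exact norm_integral_le_of_norm_le (continuous_integrable (by fun_prop))
      (ae_of_all _ (hb m s))
  · refine ae_of_all _ fun s ↦ Tendsto.const_mul _ ?_
    refine tendsto_integral_of_dominated_convergence (fun t ↦ |h t|) ?_ ?_ ?_ ?_
    · intro m
      exact (hh.measurable.mul (measurable_simpleFunc_comp (mesh m)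
        fun y ↦ kernel (mesh m s) y)).aestronglyMeasurable
    · exact (continuous_integrable (by fun_prop))
    · exact fun m ↦ ae_of_all _ (hb m s)
    · refine ae_of_all _ fun t ↦ ?_
      exact ((continuous_kernel.tendsto (s, t)).comp
        ((tendsto_mesh s).prodMk_nhds (tendsto_mesh t))).const_mul _

/-! ### Path integrals and the Gaussian law of linear functionals -/

variable {Ω : Type*} [MeasurableSpace Ω] {P : Measure Ω} {X : unitInterval → Ω → ℝ}

theorem IsStandardBridge.isProbabilityMeasure (hX : IsStandardBridge X P) :
    IsProbabilityMeasure P := hX.isGaussianProcess.isProbabilityMeasure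

theorem IsStandardBridge.covariance_eq_kernel (hX : IsStandardBridge X P) (s t : unitInterval) :
    cov[X s, X t; P] = kernel s t := by
  unfold kernel
  rcases le_total s t with h | h
  · rw [hX.covariance_eq s t h, min_eq_left (by exact_mod_cast h), max_eq_right (by exact_mod_cast h)]
  · rw [covariance_comm, hX.covariance_eq t s h, min_eq_right (by exact_mod_cast h),
      max_eq_left (by exact_mod_cast h)]

theorem IsStandardBridge.aemeasurable_mesh_integral (hX : IsStandardBridge X P)
    {h : unitInterval → ℝ} (hh : Continuous h) (m : ℕ) (g : ℝ → ℝ) (hg : Continuous g) :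
    AEMeasurable (fun ω ↦ ∫ s, h s * g (X (mesh m s) ω)) P := by
  have : (fun ω ↦ ∫ s, h s * g (X (mesh m s) ω)) =
      fun ω ↦ ∑ y ∈ (mesh m).range, (∫ s in mesh m ⁻¹' {y}, h s) * g (X y ω) := by
    ext ω
    exact integral_simpleFunc_comp_mul (mesh m) (fun y ↦ g (X y ω)) (continuous_integrable hh)
  rw [this]
  refine Finset.aemeasurable_fun_sum _ fun y _ ↦ ?_
  exact (hg.measurable.comp_aemeasurable (hX.isGaussianProcess.aemeasurable y)).const_mul _

theorem IsStandardBridge.ae_tendsto_mesh_integral (hX : IsStandardBridge X P)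
    {h : unitInterval → ℝ} (hh : Continuous h) (g : ℝ → ℝ) (hg : Continuous g) :
    ∀ᵐ ω ∂P, Tendsto (fun m ↦ ∫ s, h s * g (X (mesh m s) ω)) atTop
      (𝓝 (∫ s, h s * g (X s ω))) := by
  filter_upwards [hX.continuous_paths] with ω hω
  exact tendsto_integral_mesh (hg.comp hω) hh

theorem IsStandardBridge.aemeasurable_integral (hX : IsStandardBridge X P)
    {h : unitInterval → ℝ} (hh : Continuous h) (g : ℝ → ℝ) (hg : Continuous g) :
    AEMeasurable (fun ω ↦ ∫ s, h s * g (X s ω)) P :=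
  aemeasurable_of_tendsto_metrizable_ae atTop
    (fun m ↦ hX.aemeasurable_mesh_integral hh m g hg) (hX.ae_tendsto_mesh_integral hh g hg)

/-- The discretized functional is a finite combination of jointly Gaussian variables, so it is
Gaussian with mean zero and variance the discretized covariance form; its characteristic function is
evaluated at `1`. -/
theorem IsStandardBridge.integral_cexp_mesh (hX : IsStandardBridge X P)
    {h : unitInterval → ℝ} (hh : Continuous h) (m : ℕ) :
    ∫ ω, Complex.exp ((∫ s, h s * X (mesh m s) ω : ℝ) * Complex.I) ∂P =
      Complex.exp (-((∫ s, h s * ∫ t, h t * kernel (mesh m s) (mesh m t) : ℝ) : ℂ) / 2) := by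
  have := hX.isProbabilityMeasure
  set w : unitInterval → ℝ := fun y ↦ ∫ s in mesh m ⁻¹' {y}, h s with hw
  have hsum : ∀ ω, ∫ s, h s * X (mesh m s) ω = ∑ y ∈ (mesh m).range, w y * X y ω := fun ω ↦
    integral_simpleFunc_comp_mul (mesh m) (fun y ↦ X y ω) (continuous_integrable hh)
  have hk : ∫ s, h s * ∫ t, h t * kernel (mesh m s) (mesh m t) =
      ∑ y ∈ (mesh m).range, w y * ∑ z ∈ (mesh m).range, w z * kernel y z := by
    rw [integral_simpleFunc_comp_mul (mesh m) (fun y ↦ ∫ t, h t * kernel y (mesh m t))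
      (continuous_integrable hh)]
    refine Finset.sum_congr rfl fun y _ ↦ ?_
    rw [integral_simpleFunc_comp_mul (mesh m) (fun z ↦ kernel y z) (continuous_integrable hh)]
  simp_rw [hsum]
  rw [hk]
  have hG : HasGaussianLaw (fun ω ↦ ∑ y ∈ (mesh m).range, w y * X y ω) P :=
    (hX.isGaussianProcess.smul w).hasGaussianLaw_fun_sum
  have hmem : ∀ y, MemLp (fun ω ↦ w y * X y ω) 2 P := fun y ↦
    (hX.isGaussianProcess.hasGaussianLaw_eval y).memLp_two.const_mul (w y)
  have hmean : ∫ ω, ∑ y ∈ (mesh m).range, w y * X y ω ∂P = 0 := by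
    rw [integral_finsetSum _ fun y _ ↦ (hmem y).integrable (by norm_num)]
    refine Finset.sum_eq_zero fun y _ ↦ ?_
    rw [integral_const_mul, hX.mean_eq_zero, mul_zero]
  have hvar : Var[fun ω ↦ ∑ y ∈ (mesh m).range, w y * X y ω; P] =
      ∑ y ∈ (mesh m).range, w y * ∑ z ∈ (mesh m).range, w z * kernel y z := by
    rw [← covariance_self hG.aemeasurable,
      covariance_fun_sum_fun_sum' (fun y _ ↦ hmem y) (fun y _ ↦ hmem y)]
    refine Finset.sum_congr rfl fun y _ ↦ ?_
    rw [Finset.mul_sum]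
    refine Finset.sum_congr rfl fun z _ ↦ ?_
    rw [covariance_const_mul_left, covariance_const_mul_right, hX.covariance_eq_kernel]
  have hc := hG.charFun_map_eq (1 : ℝ)
  rw [charFun_apply_real, integral_map hG.aemeasurable (by fun_prop)] at hc
  simp only [Complex.ofReal_one, one_mul] at hc
  rw [hc]
  simp only [RCLike.inner_apply, map_one, mul_one, hmean, hvar]
  congr 1
  push_cast
  ring

/-- Smooth linear functionals of the bridge are Gaussian. -/
theorem IsStandardBridge.integral_cexp_linear (hX : IsStandardBridge X P)
    {h : unitInterval → ℝ} (hh : Continuous h) :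
    ∫ ω, Complex.exp ((∫ s, h s * X s ω : ℝ) * Complex.I) ∂P =
      Complex.exp (-(covForm h : ℂ) / 2) := by
  have := hX.isProbabilityMeasure
  have h1 : Tendsto (fun m ↦ ∫ ω, Complex.exp ((∫ s, h s * X (mesh m s) ω : ℝ) * Complex.I) ∂P)
      atTop (𝓝 (∫ ω, Complex.exp ((∫ s, h s * X s ω : ℝ) * Complex.I) ∂P)) := by
    refine tendsto_integral_of_dominated_convergence (fun _ ↦ 1) ?_ (integrable_const 1) ?_ ?_
    · intro m
      have := hX.aemeasurable_mesh_integral hh m id continuous_id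
      simp only [id] at this
      exact (by fun_prop : Continuous fun x : ℝ ↦ Complex.exp (x * Complex.I)).measurable
        |>.comp_aemeasurable this |>.aestronglyMeasurable
    · exact fun m ↦ ae_of_all _ fun ω ↦ (Complex.norm_exp_ofReal_mul_I _).le
    · filter_upwards [hX.ae_tendsto_mesh_integral hh id continuous_id] with ω hω
      exact ((by fun_prop : Continuous fun x : ℝ ↦ Complex.exp (x * Complex.I)).tendsto _).comp hω
  refine tendsto_nhds_unique h1 ?_
  simp_rw [hX.integral_cexp_mesh hh]
  exact ((by fun_prop : Continuous fun x : ℝ ↦ Complex.exp (-(x : ℂ) / 2)).tendsto _).comp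
    (tendsto_covForm_mesh hh)

/-! ### Dirichlet eigenfunctions and diagonalization of the kernel -/

theorem integral_unitInterval_coe (f : ℝ → ℝ) : ∫ t : unitInterval, f t = ∫ t in (0 : ℝ)..1, f t := by
  rw [intervalIntegral.integral_of_le zero_le_one, ← integral_Icc_eq_integral_Ioc]
  exact integral_subtype measurableSet_Icc f

/-- The square roots of the Dirichlet eigenvalues of the unit interval. -/
noncomputable def freq (n : ℕ) : ℝ := (n + 1) * Real.pi

theorem freq_pos (n : ℕ) : 0 < freq n := by unfold freq; positivity

theorem sin_freq (n : ℕ) : Real.sin (freq n) = 0 := by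
  unfold freq; exact_mod_cast Real.sin_nat_mul_pi (n + 1)

theorem cos_freq (n : ℕ) : Real.cos (freq n) = (-1) ^ (n + 1) := by
  unfold freq; exact_mod_cast Real.cos_nat_mul_pi (n + 1)

/-- The normalized Dirichlet eigenfunctions of the unit interval. -/
noncomputable def sine (n : ℕ) (t : unitInterval) : ℝ := √2 * Real.sin (freq n * t)

@[fun_prop]
theorem continuous_sine (n : ℕ) : Continuous (sine n) := by unfold sine; fun_prop

theorem integral_cos_int_mul_pi (k : ℤ) :
    ∫ t in (0 : ℝ)..1, Real.cos (k * Real.pi * t) = if k = 0 then 1 else 0 := by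
  split_ifs with hk
  · simp [hk]
  · have hk' : (k : ℝ) * Real.pi ≠ 0 := mul_ne_zero (by exact_mod_cast hk) Real.pi_ne_zero
    rw [intervalIntegral.integral_comp_mul_left (fun x ↦ Real.cos x) hk']
    simp [Real.sin_int_mul_pi]

theorem integral_sine_mul_sine (n m : ℕ) :
    ∫ t, sine n t * sine m t = if n = m then 1 else 0 := by
  have h : ∀ t : ℝ, (√2 * Real.sin (freq n * t)) * (√2 * Real.sin (freq m * t)) =
      Real.cos (((n : ℤ) - m : ℤ) * Real.pi * t) - Real.cos (((n : ℤ) + m + 2 : ℤ) * Real.pi * t) := by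
    intro t
    have h2 : √2 * √2 = (2 : ℝ) := Real.mul_self_sqrt (by norm_num)
    have e1 : (((n : ℤ) - m : ℤ) : ℝ) * Real.pi * t = freq n * t - freq m * t := by
      unfold freq; push_cast; ring
    have e2 : (((n : ℤ) + m + 2 : ℤ) : ℝ) * Real.pi * t = freq n * t + freq m * t := by
      unfold freq; push_cast; ring
    rw [e1, e2, Real.cos_sub, Real.cos_add]
    linear_combination (Real.sin (freq n * t) * Real.sin (freq m * t)) * h2
  unfold sine
  rw [integral_unitInterval_coe (fun t ↦ (√2 * Real.sin (freq n * t)) * (√2 * Real.sin (freq m * t)))]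
  simp_rw [h]
  rw [intervalIntegral.integral_sub (Continuous.intervalIntegrable (by fun_prop) _ _)
    (Continuous.intervalIntegrable (by fun_prop) _ _), integral_cos_int_mul_pi,
    integral_cos_int_mul_pi, if_neg (by omega : ¬ ((n : ℤ) + m + 2 = 0)), sub_zero]
  congr 1
  exact propext ⟨fun h ↦ by omega, fun h ↦ by omega⟩

/-- The mean of an eigenfunction. -/
noncomputable def sineMean (n : ℕ) : ℝ := √2 * (1 - (-1) ^ (n + 1)) / freq n

theorem integral_sine (n : ℕ) : ∫ t, sine n t = sineMean n := by
  unfold sine sineMean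
  rw [integral_unitInterval_coe (fun t ↦ √2 * Real.sin (freq n * t)),
    intervalIntegral.integral_const_mul,
    intervalIntegral.integral_comp_mul_left (fun x ↦ Real.sin x) (freq_pos n).ne']
  simp [cos_freq]
  ring

/-- The kernel inverts `-d²/dt²` with Dirichlet conditions. It is linear in `t` on each side of `s`,
so the integral splits there into two with explicit antiderivatives; the cosine terms cancel. -/
theorem integral_sine_mul_kernel (n : ℕ) (s : unitInterval) :
    ∫ t, sine n t * kernel s t = sine n s / freq n ^ 2 := by
  have ha := (freq_pos n).ne'
  set a := freq n with hadef
  obtain ⟨s, hs0, hs1⟩ := s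
  unfold sine kernel
  simp only
  rw [← hadef, integral_unitInterval_coe
    (fun t ↦ √2 * Real.sin (a * t) * (min s t * (1 - max s t)))]
  have hi : ∀ u v, IntervalIntegrable
      (fun t ↦ √2 * Real.sin (a * t) * (min s t * (1 - max s t))) volume u v := fun u v ↦
    Continuous.intervalIntegrable (by fun_prop) _ _
  rw [← intervalIntegral.integral_add_adjacent_intervals (hi 0 s) (hi s 1)]
  have h1 : ∫ t in (0 : ℝ)..s, √2 * Real.sin (a * t) * (min s t * (1 - max s t)) =
      ∫ t in (0 : ℝ)..s, √2 * (1 - s) * (t * Real.sin (a * t)) := by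
    refine intervalIntegral.integral_congr fun t ht ↦ ?_
    rw [Set.uIcc_of_le hs0] at ht
    simp only [min_eq_right ht.2, max_eq_left ht.2]
    ring
  have h2 : ∫ t in s..1, √2 * Real.sin (a * t) * (min s t * (1 - max s t)) =
      ∫ t in s..1, √2 * s * ((1 - t) * Real.sin (a * t)) := by
    refine intervalIntegral.integral_congr fun t ht ↦ ?_
    rw [Set.uIcc_of_le hs1] at ht
    simp only [min_eq_left ht.1, max_eq_right ht.1]
    ring
  have hsin : ∀ t, HasDerivAt (fun t ↦ Real.sin (a * t)) (a * Real.cos (a * t)) t := fun t ↦ by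
    simpa [mul_comm] using ((hasDerivAt_id t).const_mul a).sin
  have hcos : ∀ t, HasDerivAt (fun t ↦ Real.cos (a * t)) (-(a * Real.sin (a * t))) t := fun t ↦ by
    simpa [mul_comm] using ((hasDerivAt_id t).const_mul a).cos
  have f1 : ∫ t in (0 : ℝ)..s, t * Real.sin (a * t) =
      -(s * Real.cos (a * s)) / a + Real.sin (a * s) / a ^ 2 := by
    rw [intervalIntegral.integral_eq_sub_of_hasDerivAt
      (f := fun t ↦ -(t * Real.cos (a * t)) / a + Real.sin (a * t) / a ^ 2)
      (fun t _ ↦ ?_) (Continuous.intervalIntegrable (by fun_prop) _ _)]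
    · simp
    · convert! ((((hasDerivAt_id t).mul (hcos t)).neg).div_const a).add
        ((hsin t).div_const (a ^ 2)) using 1
      simp; field_simp; ring
  have f2 : ∫ t in s..1, (1 - t) * Real.sin (a * t) =
      (1 - s) * Real.cos (a * s) / a + Real.sin (a * s) / a ^ 2 := by
    rw [intervalIntegral.integral_eq_sub_of_hasDerivAt
      (f := fun t ↦ -((1 - t) * Real.cos (a * t)) / a - Real.sin (a * t) / a ^ 2)
      (fun t _ ↦ ?_) (Continuous.intervalIntegrable (by fun_prop) _ _)]
    · rw [mul_one, hadef, sin_freq]; ring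
    · convert! (((((hasDerivAt_id t).const_sub 1).mul (hcos t)).neg).div_const a).sub
        ((hsin t).div_const (a ^ 2)) using 1
      simp; field_simp; ring
  rw [h1, h2, intervalIntegral.integral_const_mul, intervalIntegral.integral_const_mul, f1, f2]
  ring

theorem integral_sum_mul_sine (N : ℕ) (x : ℕ → ℝ) (m : ℕ) :
    ∫ s, (∑ n ∈ Finset.range N, x n * sine n s) * sine m s =
      if m < N then x m else 0 := by
  simp_rw [Finset.sum_mul, mul_assoc]
  rw [integral_finsetSum _ fun n _ ↦ continuous_integrable (by fun_prop)]
  simp_rw [integral_const_mul, integral_sine_mul_sine]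
  simp

theorem integral_sum_mul_sum (N : ℕ) (x y : ℕ → ℝ) :
    ∫ s, (∑ n ∈ Finset.range N, x n * sine n s) * (∑ n ∈ Finset.range N, y n * sine n s) =
      ∑ n ∈ Finset.range N, x n * y n := by
  simp_rw [Finset.mul_sum, mul_left_comm _ (y _)]
  rw [integral_finsetSum _ fun n _ ↦ continuous_integrable (by fun_prop)]
  refine Finset.sum_congr rfl fun n hn ↦ ?_
  rw [integral_const_mul, integral_sum_mul_sine, if_pos (Finset.mem_range.1 hn), mul_comm]

/-- The covariance form is diagonal in the eigenfunctions. -/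
theorem covForm_sum_sine (N : ℕ) (x : ℕ → ℝ) :
    covForm (fun s ↦ ∑ n ∈ Finset.range N, x n * sine n s) =
      ∑ n ∈ Finset.range N, x n ^ 2 / freq n ^ 2 := by
  have hk : ∀ s, Continuous fun t ↦ kernel s t := fun s ↦
    continuous_kernel.comp (by fun_prop : Continuous fun t : unitInterval ↦ (s, t))
  have : ∀ s, ∫ t, (∑ n ∈ Finset.range N, x n * sine n t) * kernel s t =
      ∑ n ∈ Finset.range N, (x n / freq n ^ 2) * sine n s := by
    intro s
    simp_rw [Finset.sum_mul, mul_assoc]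
    rw [integral_finsetSum _ fun n _ ↦ continuous_integrable (by have := hk s; fun_prop)]
    refine Finset.sum_congr rfl fun n _ ↦ ?_
    rw [integral_const_mul, integral_sine_mul_kernel]
    ring
  unfold covForm
  simp_rw [this]
  rw [integral_sum_mul_sum]
  exact Finset.sum_congr rfl fun n _ ↦ by ring

/-! ### Bessel's inequality and the trace of the kernel -/

/-- The sine coefficients of a path. -/
noncomputable def sineCoeff (g : unitInterval → ℝ) (n : ℕ) : ℝ := ∫ s, sine n s * g s

theorem integral_sum_sine_mul {g : unitInterval → ℝ} (hg : Continuous g) (N : ℕ) (x : ℕ → ℝ) :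
    ∫ s, (∑ n ∈ Finset.range N, x n * sine n s) * g s =
      ∑ n ∈ Finset.range N, x n * sineCoeff g n := by
  simp_rw [Finset.sum_mul, mul_assoc]
  rw [integral_finsetSum _ fun n _ ↦ continuous_integrable (by fun_prop)]
  exact Finset.sum_congr rfl fun n _ ↦ integral_const_mul _ _

theorem integral_sub_sum_sine_sq {g : unitInterval → ℝ} (hg : Continuous g) (N : ℕ) :
    ∫ s, (g s - ∑ n ∈ Finset.range N, sineCoeff g n * sine n s) ^ 2 =
      (∫ s, g s ^ 2) - ∑ n ∈ Finset.range N, sineCoeff g n ^ 2 := by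
  have h : ∀ s, (g s - ∑ n ∈ Finset.range N, sineCoeff g n * sine n s) ^ 2 =
      g s ^ 2 - 2 * ((∑ n ∈ Finset.range N, sineCoeff g n * sine n s) * g s) +
      (∑ n ∈ Finset.range N, sineCoeff g n * sine n s) *
        (∑ n ∈ Finset.range N, sineCoeff g n * sine n s) := fun s ↦ by ring
  simp_rw [h]
  rw [integral_add (continuous_integrable (by fun_prop)) (continuous_integrable (by fun_prop)),
    integral_sub (continuous_integrable (by fun_prop)) (continuous_integrable (by fun_prop)),
    integral_const_mul, integral_sum_sine_mul hg, integral_sum_mul_sum]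
  simp_rw [pow_two]
  ring

theorem sum_sineCoeff_sq_le {g : unitInterval → ℝ} (hg : Continuous g) (N : ℕ) :
    ∑ n ∈ Finset.range N, sineCoeff g n ^ 2 ≤ ∫ s, g s ^ 2 := by
  have := integral_sub_sum_sine_sq hg N
  have h0 : 0 ≤ ∫ s, (g s - ∑ n ∈ Finset.range N, sineCoeff g n * sine n s) ^ 2 :=
    integral_nonneg fun s ↦ sq_nonneg _
  linarith

/-- Cauchy–Schwarz against `1`, as nonnegativity of a variance. -/
theorem sq_integral_le {g : unitInterval → ℝ} (hg : Continuous g) :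
    (∫ s, g s) ^ 2 ≤ ∫ s, g s ^ 2 := by
  have h : ∀ s, (g s - ∫ t, g t) ^ 2 = g s ^ 2 - 2 * (∫ t, g t) * g s + (∫ t, g t) ^ 2 :=
    fun s ↦ by ring
  have h0 : 0 ≤ ∫ s, (g s - ∫ t, g t) ^ 2 := integral_nonneg fun s ↦ sq_nonneg _
  simp_rw [h] at h0
  rw [integral_add (continuous_integrable (by fun_prop)) (continuous_integrable (by fun_prop)),
    integral_sub (continuous_integrable (by fun_prop)) (continuous_integrable (by fun_prop)),
    integral_const_mul] at h0
  simp at h0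
  nlinarith

theorem integral_sum_sine (N : ℕ) (x : ℕ → ℝ) :
    ∫ s, ∑ n ∈ Finset.range N, x n * sine n s = ∑ n ∈ Finset.range N, x n * sineMean n := by
  rw [integral_finsetSum _ fun n _ ↦ continuous_integrable (by fun_prop)]
  exact Finset.sum_congr rfl fun n _ ↦ by rw [integral_const_mul, integral_sine]

theorem sq_sum_mul_sineMean_le (N : ℕ) (x : ℕ → ℝ) :
    (∑ n ∈ Finset.range N, x n * sineMean n) ^ 2 ≤ ∑ n ∈ Finset.range N, x n ^ 2 := by
  rw [← integral_sum_sine]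
  refine (sq_integral_le (by fun_prop)).trans_eq ?_
  simp_rw [pow_two, integral_sum_mul_sum]

/-- The error of the linear functional is controlled by the Parseval defect, so convergence of the
quadratic sum forces convergence of the linear one. -/
theorem sq_integral_sub_sum_le {g : unitInterval → ℝ} (hg : Continuous g) (N : ℕ) :
    ((∫ s, g s) - ∑ n ∈ Finset.range N, sineCoeff g n * sineMean n) ^ 2 ≤
      (∫ s, g s ^ 2) - ∑ n ∈ Finset.range N, sineCoeff g n ^ 2 := by
  rw [← integral_sub_sum_sine_sq hg, ← integral_sum_sine,
    ← integral_sub (continuous_integrable hg) (continuous_integrable (by fun_prop))]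
  exact sq_integral_le (by fun_prop)

theorem hasSum_inv_freq_sq : HasSum (fun n ↦ 1 / freq n ^ 2) (1 / 6) := by
  have h := (hasSum_nat_add_iff' (f := fun n : ℕ ↦ (1 : ℝ) / (n : ℝ) ^ 2) 1).2 hasSum_zeta_two
  simp only [Finset.range_one, Finset.sum_singleton, Nat.cast_zero] at h
  convert! h.mul_right (1 / Real.pi ^ 2) using 1
  · ext n; unfold freq; push_cast; field_simp
  · have := Real.pi_ne_zero
    norm_num; field_simp

theorem integral_kernel_diag : ∫ s, kernel s s = 1 / 6 := by
  unfold kernel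
  simp only [min_self, max_self]
  rw [integral_unitInterval_coe (fun s ↦ s * (1 - s))]
  have : ∀ s : ℝ, s * (1 - s) = s - s ^ 2 := fun s ↦ by ring
  simp_rw [this]
  rw [intervalIntegral.integral_sub (Continuous.intervalIntegrable (by fun_prop) _ _)
    (Continuous.intervalIntegrable (by fun_prop) _ _)]
  simp
  norm_num

/-! ### Joint law of the sine coefficients and almost sure Parseval identity -/

theorem IsStandardBridge.aemeasurable_sineCoeff (hX : IsStandardBridge X P) (n : ℕ) :
    AEMeasurable (fun ω ↦ sineCoeff (fun s ↦ X s ω) n) P :=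
  hX.aemeasurable_integral (continuous_sine n) id continuous_id

theorem IsStandardBridge.aemeasurable_integral_sq (hX : IsStandardBridge X P) :
    AEMeasurable (fun ω ↦ ∫ s, X s ω ^ 2) P := by
  simpa using hX.aemeasurable_integral (h := fun _ ↦ 1) continuous_const (fun x ↦ x ^ 2)
    (by fun_prop)

theorem IsStandardBridge.aemeasurable_integral_path (hX : IsStandardBridge X P) :
    AEMeasurable (fun ω ↦ ∫ s, X s ω) P := by
  simpa using hX.aemeasurable_integral (h := fun _ ↦ 1) continuous_const id continuous_id

/-- The characteristic function of the first sine coefficients. -/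
theorem IsStandardBridge.integral_cexp_sineCoeff (hX : IsStandardBridge X P) (N : ℕ)
    (x : ℕ → ℝ) :
    ∫ ω, Complex.exp ((∑ n ∈ Finset.range N, x n * sineCoeff (fun s ↦ X s ω) n : ℝ) *
      Complex.I) ∂P =
      ∏ n ∈ Finset.range N, Complex.exp (-(x n ^ 2 / freq n ^ 2 : ℝ) / 2) := by
  rw [← Complex.exp_sum, ← Finset.sum_div, Finset.sum_neg_distrib, ← Complex.ofReal_sum,
    ← covForm_sum_sine, ← hX.integral_cexp_linear (by fun_prop)]
  refine integral_congr_ae ?_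
  filter_upwards [hX.continuous_paths] with ω hω
  rw [integral_sum_sine_mul hω]

theorem IsStandardBridge.charFun_sineCoeff (hX : IsStandardBridge X P) (n : ℕ) (t : ℝ) :
    charFun (P.map fun ω ↦ sineCoeff (fun s ↦ X s ω) n) t =
      Complex.exp (-(t ^ 2 / freq n ^ 2 : ℝ) / 2) := by
  rw [charFun_apply_real, integral_map (hX.aemeasurable_sineCoeff n) (by fun_prop)]
  have := hX.integral_cexp_sineCoeff (n + 1) (fun m ↦ if m = n then t else 0)
  rw [Finset.prod_eq_single n (fun m _ hm ↦ by simp [hm]) (by simp)] at this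
  simpa using this

theorem IsStandardBridge.map_sineCoeff (hX : IsStandardBridge X P) (n : ℕ) :
    P.map (fun ω ↦ sineCoeff (fun s ↦ X s ω) n) =
      gaussianReal 0 (1 / freq n ^ 2).toNNReal := by
  have := hX.isProbabilityMeasure
  refine Measure.ext_of_charFun (funext fun t ↦ ?_)
  rw [hX.charFun_sineCoeff, charFun_gaussianReal, Real.coe_toNNReal _ (by positivity)]
  congr 1
  push_cast
  ring

theorem IsStandardBridge.iIndepFun_sineCoeff (hX : IsStandardBridge X P) (N : ℕ) :
    iIndepFun (fun (n : Fin N) ω ↦ sineCoeff (fun s ↦ X s ω) n) P := by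
  have := hX.isProbabilityMeasure
  rw [iIndepFun_iff_charFun_pi fun n : Fin N ↦ hX.aemeasurable_sineCoeff n]
  intro t
  simp_rw [hX.charFun_sineCoeff]
  rw [charFun_apply, integral_map ?_ (by fun_prop)]
  · have := hX.integral_cexp_sineCoeff N (fun m ↦ if h : m < N then t ⟨m, h⟩ else 0)
    rw [Finset.prod_range] at this
    simp only [Fin.is_lt, dite_true, Fin.eta] at this
    rw [← this]
    congr 1
    ext ω
    rw [Finset.sum_range]
    simp [PiLp.inner_apply]
  · have := fun n : Fin N ↦ hX.aemeasurable_sineCoeff n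
    fun_prop

/-- Fatou's lemma along the discretizations, whose expectations tend to the trace of the kernel. The
upper bound suffices, since Bessel's inequality supplies the opposite one. -/
theorem IsStandardBridge.lintegral_integral_sq_le (hX : IsStandardBridge X P) :
    ∫⁻ ω, ENNReal.ofReal (∫ s, X s ω ^ 2) ∂P ≤ ENNReal.ofReal (1 / 6) := by
  have := hX.isProbabilityMeasure
  have hsq : Continuous fun x : ℝ ↦ x ^ 2 := by fun_prop
  have hQm : ∀ m, ∫⁻ ω, ENNReal.ofReal (∫ s, 1 * X (mesh m s) ω ^ 2) ∂P =
      ENNReal.ofReal (∫ s, 1 * kernel (mesh m s) (mesh m s)) := by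
    intro m
    have hw : ∀ y, 0 ≤ ∫ s in mesh m ⁻¹' {y}, (1 : ℝ) := fun y ↦ integral_nonneg fun _ ↦ zero_le_one
    have hi : ∀ y, Integrable (fun ω ↦ X y ω ^ 2) P := fun y ↦
      (hX.isGaussianProcess.hasGaussianLaw_eval y).memLp_two.integrable_sq
    have hsum : ∀ ω, ∫ s, 1 * X (mesh m s) ω ^ 2 =
        ∑ y ∈ (mesh m).range, (∫ s in mesh m ⁻¹' {y}, (1 : ℝ)) * X y ω ^ 2 := fun ω ↦
      integral_simpleFunc_comp_mul (mesh m) (fun y ↦ X y ω ^ 2) (integrable_const 1)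
    simp_rw [hsum]
    rw [integral_simpleFunc_comp_mul (mesh m) (fun y ↦ kernel y y) (integrable_const 1),
      ← ofReal_integral_eq_lintegral_ofReal
        (integrable_finsetSum _ fun y _ ↦ (hi y).const_mul _)
        (ae_of_all _ fun ω ↦ Finset.sum_nonneg fun y _ ↦ mul_nonneg (hw y) (sq_nonneg _)),
      integral_finsetSum _ fun y _ ↦ (hi y).const_mul _]
    congr 1
    refine Finset.sum_congr rfl fun y _ ↦ ?_
    rw [integral_const_mul, ← hX.covariance_eq_kernel, covariance_self
      (hX.isGaussianProcess.aemeasurable y), variance_of_integral_eq_zero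
      (hX.isGaussianProcess.aemeasurable y) (hX.mean_eq_zero y)]
  have hlim := tendsto_integral_mesh (g := fun s ↦ kernel s s) (h := fun _ ↦ 1)
    (continuous_kernel.comp (by fun_prop : Continuous fun s : unitInterval ↦ (s, s)))
    continuous_const
  simp only [one_mul (kernel _ _)] at hlim hQm
  rw [integral_kernel_diag] at hlim
  calc ∫⁻ ω, ENNReal.ofReal (∫ s, X s ω ^ 2) ∂P
      = ∫⁻ ω, liminf (fun m ↦ ENNReal.ofReal (∫ s, 1 * X (mesh m s) ω ^ 2)) atTop ∂P := by
        refine lintegral_congr_ae ?_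
        filter_upwards [hX.ae_tendsto_mesh_integral (h := fun _ ↦ 1) continuous_const _ hsq]
          with ω hω
        have := (ENNReal.continuous_ofReal.tendsto _).comp hω
        simp only [one_mul (X _ _ ^ 2)] at this ⊢
        exact this.liminf_eq.symm
    _ ≤ liminf (fun m ↦ ∫⁻ ω, ENNReal.ofReal (∫ s, 1 * X (mesh m s) ω ^ 2) ∂P) atTop :=
        lintegral_liminf_le' fun m ↦ (hX.aemeasurable_mesh_integral (h := fun _ ↦ 1)
          continuous_const m _ hsq).ennreal_ofReal
    _ = ENNReal.ofReal (1 / 6) := by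
        simp_rw [hQm]
        exact ((ENNReal.continuous_ofReal.tendsto _).comp hlim).liminf_eq

theorem IsStandardBridge.lintegral_sineCoeff_sq (hX : IsStandardBridge X P) (n : ℕ) :
    ∫⁻ ω, ENNReal.ofReal (sineCoeff (fun s ↦ X s ω) n ^ 2) ∂P =
      ENNReal.ofReal (1 / freq n ^ 2) := by
  have hm := hX.aemeasurable_sineCoeff n
  have h2 : MemLp id 2 (gaussianReal 0 (1 / freq n ^ 2).toNNReal) := memLp_id_gaussianReal 2
  have hv := variance_id_gaussianReal (μ := 0) (v := (1 / freq n ^ 2).toNNReal)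
  rw [variance_of_integral_eq_zero aemeasurable_id (by simp),
    Real.coe_toNNReal _ (by positivity)] at hv
  rw [← hv, ofReal_integral_eq_lintegral_ofReal h2.integrable_sq
    (ae_of_all _ fun _ ↦ sq_nonneg _), ← hX.map_sineCoeff, lintegral_map' (by fun_prop) hm]
  rfl

/-- Parseval's identity for almost every path, from equality of expectations. -/
theorem IsStandardBridge.ae_tendsto_sum_sineCoeff_sq (hX : IsStandardBridge X P) :
    ∀ᵐ ω ∂P, Tendsto (fun N ↦ ∑ n ∈ Finset.range N, sineCoeff (fun s ↦ X s ω) n ^ 2) atTop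
      (𝓝 (∫ s, X s ω ^ 2)) := by
  have hm := fun n ↦ ((hX.aemeasurable_sineCoeff n).pow_const 2).ennreal_ofReal
  have hle : (fun ω ↦ ∑' n, ENNReal.ofReal (sineCoeff (fun s ↦ X s ω) n ^ 2)) ≤ᵐ[P]
      fun ω ↦ ENNReal.ofReal (∫ s, X s ω ^ 2) := by
    filter_upwards [hX.continuous_paths] with ω hω
    refine ENNReal.tsum_le_of_sum_range_le fun N ↦ ?_
    rw [← ENNReal.ofReal_sum_of_nonneg fun _ _ ↦ sq_nonneg _]
    exact ENNReal.ofReal_le_ofReal (sum_sineCoeff_sq_le hω N)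
  have hint : ∫⁻ ω, ∑' n, ENNReal.ofReal (sineCoeff (fun s ↦ X s ω) n ^ 2) ∂P =
      ENNReal.ofReal (1 / 6) := by
    rw [lintegral_tsum hm]
    simp_rw [hX.lintegral_sineCoeff_sq]
    rw [← hasSum_inv_freq_sq.tsum_eq, ENNReal.ofReal_tsum_of_nonneg (fun n ↦ by positivity)
      hasSum_inv_freq_sq.summable]
  -- A pointwise inequality whose larger side has no larger integral, with finite integrals, is an
  -- equality almost everywhere.
  have heq := ae_eq_of_ae_le_of_lintegral_le hle (by rw [hint]; exact ENNReal.ofReal_ne_top)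
    hX.aemeasurable_integral_sq.ennreal_ofReal (hX.lintegral_integral_sq_le.trans hint.ge)
  filter_upwards [heq] with ω hω
  have ht := ENNReal.summable.hasSum_iff_tendsto_nat.1
    (ENNReal.summable (f := fun n ↦ ENNReal.ofReal (sineCoeff (fun s ↦ X s ω) n ^ 2))).hasSum
  rw [hω] at ht
  have := (ENNReal.tendsto_toReal ENNReal.ofReal_ne_top).comp ht
  rw [ENNReal.toReal_ofReal (integral_nonneg fun _ ↦ sq_nonneg _)] at this
  refine this.congr fun N ↦ ?_
  rw [Function.comp_apply, ← ENNReal.ofReal_sum_of_nonneg fun _ _ ↦ sq_nonneg _,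
    ENNReal.toReal_ofReal (Finset.sum_nonneg fun _ _ ↦ sq_nonneg _)]

theorem IsStandardBridge.ae_tendsto_sum_sineCoeff_mul_sineMean (hX : IsStandardBridge X P) :
    ∀ᵐ ω ∂P, Tendsto (fun N ↦ ∑ n ∈ Finset.range N, sineCoeff (fun s ↦ X s ω) n * sineMean n)
      atTop (𝓝 (∫ s, X s ω)) := by
  filter_upwards [hX.continuous_paths, hX.ae_tendsto_sum_sineCoeff_sq] with ω hω hlim
  have h1 : Tendsto (fun N ↦ √((∫ s, X s ω ^ 2) -
      ∑ n ∈ Finset.range N, sineCoeff (fun s ↦ X s ω) n ^ 2)) atTop (𝓝 0) := by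
    have := (hlim.const_sub (∫ s, X s ω ^ 2)).sqrt
    rwa [sub_self, Real.sqrt_zero] at this
  rw [tendsto_iff_norm_sub_tendsto_zero]
  refine squeeze_zero (fun _ ↦ norm_nonneg _) (fun N ↦ ?_) h1
  rw [norm_sub_rev]
  exact Real.abs_le_sqrt (sq_integral_sub_sum_le hω N)

/-! ### Gaussian integral of one eigenmode -/

/-- The normalization of the Gaussian integral of an eigenmode. -/
noncomputable def modeConst (ζ : ℂ) (n : ℕ) : ℂ :=
  (freq n / √(2 * Real.pi) : ℝ) * (Real.pi / ((freq n ^ 2 + ζ) / 2)) ^ (1 / 2 : ℂ)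

/-- The lowest Dirichlet eigenvalue is `π²`; this is the origin of the threshold. -/
theorem freq_sq_add_re_pos {ζ : ℂ} (hζ : -Real.pi ^ 2 < ζ.re) (n : ℕ) :
    0 < ((freq n : ℂ) ^ 2 + ζ).re := by
  have h1 : ((freq n : ℂ) ^ 2).re = freq n ^ 2 := by norm_cast
  rw [Complex.add_re, h1]
  have h2 : Real.pi ≤ freq n := by
    unfold freq
    nlinarith [Real.pi_pos, (Nat.cast_nonneg n : (0 : ℝ) ≤ n)]
  nlinarith [Real.pi_pos]

theorem freq_sq_add_ne_zero {ζ : ℂ} (hζ : -Real.pi ^ 2 < ζ.re) (n : ℕ) :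
    (freq n : ℂ) ^ 2 + ζ ≠ 0 := fun h ↦ by
  simpa [h] using freq_sq_add_re_pos hζ n

theorem ofReal_freq_ne_zero (n : ℕ) : (freq n : ℂ) ≠ 0 := by
  exact_mod_cast (freq_pos n).ne'

/-- Squaring removes the complex power and leaves the inverse of one Euler factor. -/
theorem modeConst_sq {ζ : ℂ} (hζ : -Real.pi ^ 2 < ζ.re) (n : ℕ) :
    modeConst ζ n ^ 2 = (1 + ζ / freq n ^ 2)⁻¹ := by
  have h0 := freq_sq_add_ne_zero hζ n
  have hf := ofReal_freq_ne_zero n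
  have hpi : (Real.pi : ℂ) ≠ 0 := by exact_mod_cast Real.pi_ne_zero
  have h1 : ((√(2 * Real.pi) : ℝ) : ℂ) ^ 2 = 2 * Real.pi := by
    rw [← Complex.ofReal_pow, Real.sq_sqrt (by positivity)]; push_cast; rfl
  unfold modeConst
  rw [mul_pow, one_div, Complex.cpow_ofNat_inv_pow, Complex.ofReal_div, div_pow, h1]
  have h2 : 1 + ζ / (freq n : ℂ) ^ 2 = ((freq n : ℂ) ^ 2 + ζ) / freq n ^ 2 := by field_simp
  rw [h2]
  field_simp

theorem modeConst_ne_zero {ζ : ℂ} (hζ : -Real.pi ^ 2 < ζ.re) (n : ℕ) :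
    modeConst ζ n ≠ 0 := by
  intro h
  have h2 := modeConst_sq hζ n
  rw [h] at h2
  have h0 := freq_sq_add_ne_zero hζ n
  have hf := ofReal_freq_ne_zero n
  have h3 : 1 + ζ / (freq n : ℂ) ^ 2 = ((freq n : ℂ) ^ 2 + ζ) / freq n ^ 2 := by field_simp
  rw [h3] at h2
  exact (inv_ne_zero (div_ne_zero h0 (pow_ne_zero 2 hf))) (by simpa using h2.symm)

/-- The Gaussian integral of an eigenmode. -/
theorem integral_cexp_gaussianReal {ζ : ℂ} (hζ : -Real.pi ^ 2 < ζ.re) (c : ℂ) (n : ℕ) :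
    ∫ x : ℝ, Complex.exp (c * x - ζ / 2 * x ^ 2) ∂(gaussianReal 0 (1 / freq n ^ 2).toNNReal) =
      modeConst ζ n * Complex.exp (c ^ 2 / (2 * (freq n ^ 2 + ζ))) := by
  have hf := freq_pos n
  have hv : (1 / freq n ^ 2).toNNReal ≠ 0 := by
    rw [Ne, Real.toNNReal_eq_zero, not_le]; positivity
  have hb : (-((freq n : ℂ) ^ 2 + ζ) / 2).re < 0 := by
    have := freq_sq_add_re_pos hζ n
    rw [show (-((freq n : ℂ) ^ 2 + ζ) / 2) = ((-1 / 2 : ℝ) : ℂ) * ((freq n : ℂ) ^ 2 + ζ) by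
      push_cast; ring, Complex.re_ofReal_mul]
    linarith
  rw [integral_gaussianReal_eq_integral_smul hv]
  have hpdf : ∀ x : ℝ, gaussianPDFReal 0 (1 / freq n ^ 2).toNNReal x •
      Complex.exp (c * x - ζ / 2 * x ^ 2) = (freq n / √(2 * Real.pi) : ℝ) *
        Complex.exp (-((freq n : ℂ) ^ 2 + ζ) / 2 * x ^ 2 + c * x + 0) := by
    intro x
    rw [gaussianPDFReal, Real.coe_toNNReal _ (by positivity), Complex.real_smul,
      Complex.ofReal_mul, Complex.ofReal_exp, mul_assoc, ← Complex.exp_add]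
    congr 2
    · rw [mul_one_div, Real.sqrt_div (by positivity), Real.sqrt_sq hf.le, inv_div]
    · push_cast
      field_simp
      ring
  simp_rw [hpdf]
  rw [integral_const_mul, integral_cexp_quadratic hb, modeConst, mul_assoc]
  have h0 := freq_sq_add_ne_zero hζ n
  congr 3
  · congr 1; ring
  · field_simp; ring

/-! ### Euler's product and the partial fractions of `coth` and `tanh` -/

theorem div_pi_mem_integerComplement {z : ℂ} (hz : z.re ≠ 0) :
    z * Complex.I / Real.pi ∈ Complex.integerComplement := by
  rw [Complex.mem_integerComplement_iff]
  rintro ⟨n, hn⟩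
  have hpi : (Real.pi : ℂ) ≠ 0 := by exact_mod_cast Real.pi_ne_zero
  rw [eq_div_iff hpi] at hn
  have := congrArg Complex.im hn
  simp at this
  exact hz this.symm

theorem sinh_ne_zero {z : ℂ} (hz : z.re ≠ 0) : Complex.sinh z ≠ 0 := by
  have h := sin_pi_mul_ne_zero (div_pi_mem_integerComplement hz)
  have hpi : (Real.pi : ℂ) ≠ 0 := by exact_mod_cast Real.pi_ne_zero
  rw [mul_div_cancel₀ _ hpi, Complex.sin_mul_I] at h
  exact left_ne_zero_of_mul h

theorem cosh_ne_zero {z : ℂ} (hz : z.re ≠ 0) : Complex.cosh z ≠ 0 := by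
  have h : Complex.sinh (2 * z) ≠ 0 := sinh_ne_zero (by simpa using hz)
  rw [Complex.sinh_two_mul] at h
  exact right_ne_zero_of_mul h

/-- Euler's product for `sinh z / z`. -/
theorem tendsto_prod_one_add_sq_div {z : ℂ} (hz : z ≠ 0) :
    Tendsto (fun N ↦ ∏ n ∈ Finset.range N, (1 + z ^ 2 / freq n ^ 2)) atTop
      (𝓝 (Complex.sinh z / z)) := by
  have hpi : (Real.pi : ℂ) ≠ 0 := by exact_mod_cast Real.pi_ne_zero
  have h := (Complex.tendsto_euler_sin_prod (z * Complex.I / Real.pi)).const_mul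
    (1 / (z * Complex.I))
  rw [mul_div_cancel₀ _ hpi, Complex.sin_mul_I] at h
  have hzI : z * Complex.I ≠ 0 := mul_ne_zero hz Complex.I_ne_zero
  convert! h using 1
  · ext N
    rw [← mul_assoc, one_div, inv_mul_cancel₀ hzI, one_mul]
    refine Finset.prod_congr rfl fun n _ ↦ ?_
    unfold freq
    push_cast
    rw [div_pow, mul_pow z, Complex.I_sq, mul_pow _ (Real.pi : ℂ)]
    have : ((n : ℂ) + 1) ≠ 0 := Nat.cast_add_one_ne_zero n
    field_simp
    ring
  · field_simp

/-- Assuming `sinh z ≠ 0` rather than `z.re ≠ 0` keeps imaginary `z` available for the exponential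
moments. -/
theorem tendsto_prod_modeConst_sq {z : ℂ} (hz : z ≠ 0) (hs : Complex.sinh z ≠ 0)
    (hζ : -Real.pi ^ 2 < (z ^ 2).re) :
    Tendsto (fun N ↦ (∏ n ∈ Finset.range N, modeConst (z ^ 2) n) ^ 2) atTop
      (𝓝 (z / Complex.sinh z)) := by
  have h := (tendsto_prod_one_add_sq_div hz).inv₀ (div_ne_zero hs hz)
  rw [inv_div] at h
  refine h.congr fun N ↦ ?_
  rw [← Finset.prod_pow, ← Finset.prod_inv_distrib]
  exact Finset.prod_congr rfl fun n _ ↦ (modeConst_sq hζ n).symm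

/-- Sums over the eigenmodes of nonzero mean. -/
theorem hasSum_one_sub_neg_one_pow_mul {g : ℕ → ℂ} {A B : ℂ} (hA : HasSum g A)
    (hB : HasSum (fun k ↦ g (2 * k + 1)) B) :
    HasSum (fun n ↦ (1 - (-1) ^ (n + 1)) * g n) (2 * A - 2 * B) := by
  have hinj : Function.Injective fun k : ℕ ↦ 2 * k + 1 := fun a b h ↦ by simpa using h
  -- The weight is `2` for even `n` and `0` for odd `n`, so the sum is twice the total minus twice
  -- the odd part.
  have hB' : HasSum (fun n ↦ if Odd n then g n else 0) B := by
    rw [← hinj.hasSum_iff]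
    · convert! hB using 2 with k
      simp
    · intro n hn
      rw [if_neg]
      rintro ⟨k, rfl⟩
      exact hn ⟨k, rfl⟩
  convert! (hA.mul_left 2).sub (hB'.mul_left 2) using 1
  ext n
  rcases Nat.even_or_odd n with h | h
  · rw [pow_succ, h.neg_one_pow, if_neg (Nat.not_odd_iff_even.2 h)]; ring
  · rw [pow_succ, h.neg_one_pow, if_pos h]; ring

/-- Sums over odd indices thereby become rescaled full sums. -/
theorem freq_two_mul_add_one (k : ℕ) : freq (2 * k + 1) = 2 * freq k := by
  unfold freq; push_cast; ring

theorem sineMean_sq (n : ℕ) :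
    (sineMean n : ℂ) ^ 2 = 4 * ((1 - (-1) ^ (n + 1)) * (1 / (freq n : ℂ) ^ 2)) := by
  have h2 : ((√2 : ℝ) : ℂ) ^ 2 = 2 := by
    rw [← Complex.ofReal_pow, Real.sq_sqrt (by norm_num)]; norm_num
  have h3 : ((-1 : ℂ) ^ (n + 1)) ^ 2 = 1 := by rw [← pow_mul, mul_comm, pow_mul]; simp
  unfold sineMean
  push_cast
  rw [div_pow, mul_pow, h2]
  linear_combination (2 / (freq n : ℂ) ^ 2) * h3

theorem hasSum_sineMean_sq : HasSum (fun n ↦ (sineMean n : ℂ) ^ 2) 1 := by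
  have hA : HasSum (fun n ↦ 1 / (freq n : ℂ) ^ 2) (1 / 6) := by
    have := Complex.hasSum_ofReal.2 hasSum_inv_freq_sq
    push_cast at this
    exact this
  have hB : HasSum (fun k ↦ 1 / (freq (2 * k + 1) : ℂ) ^ 2) (1 / 24) := by
    convert! hA.mul_left (1 / 4) using 1
    · ext k; rw [freq_two_mul_add_one]; push_cast; ring
    · norm_num
  simp_rw [sineMean_sq]
  convert! (hasSum_one_sub_neg_one_pow_mul hA hB).mul_left 4 using 1
  norm_num

theorem hasSum_inv_freq_four : HasSum (fun n ↦ 1 / freq n ^ 4) (1 / 90) := by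
  have h := (hasSum_nat_add_iff' (f := fun n : ℕ ↦ (1 : ℝ) / (n : ℝ) ^ 4) 1).2 hasSum_zeta_four
  simp only [Finset.range_one, Finset.sum_singleton, Nat.cast_zero] at h
  convert! h.mul_right (1 / Real.pi ^ 4) using 1
  · ext n; unfold freq; push_cast; field_simp
  · have := Real.pi_ne_zero
    norm_num; field_simp

/-- The case `ζ = 0`, where the `tanh` formula degenerates; `+ 0` matches the general shape. -/
theorem hasSum_sineMean_sq_div_freq_sq :
    HasSum (fun n ↦ (sineMean n : ℂ) ^ 2 / (freq n ^ 2 + 0)) (1 / 12) := by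
  have hA : HasSum (fun n ↦ 1 / (freq n : ℂ) ^ 4) (1 / 90) := by
    have := Complex.hasSum_ofReal.2 hasSum_inv_freq_four
    push_cast at this
    exact this
  have hB : HasSum (fun k ↦ 1 / (freq (2 * k + 1) : ℂ) ^ 4) (1 / 1440) := by
    convert! hA.mul_left (1 / 16) using 1
    · ext k; rw [freq_two_mul_add_one]; push_cast; ring
    · norm_num
  simp_rw [sineMean_sq]
  convert! (hasSum_one_sub_neg_one_pow_mul hA hB).mul_left 4 using 1
  · ext n; have := ofReal_freq_ne_zero n; field_simp; ring
  · norm_num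

/-- The partial fraction expansion of the hyperbolic cotangent. -/
theorem hasSum_one_div_freq_sq_add_sq {z : ℂ} (hz : z.re ≠ 0)
    (hζ : ∀ n, (freq n : ℂ) ^ 2 + z ^ 2 ≠ 0) :
    HasSum (fun n ↦ 1 / ((freq n : ℂ) ^ 2 + z ^ 2))
      ((Complex.cosh z / Complex.sinh z - 1 / z) / (2 * z)) := by
  have hw := div_pi_mem_integerComplement hz
  have hpi : (Real.pi : ℂ) ≠ 0 := by exact_mod_cast Real.pi_ne_zero
  have hz0 : z ≠ 0 := by rintro rfl; simp at hz
  have hs := sinh_ne_zero hz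
  have hI := Complex.I_ne_zero
  have h := (summable_cotTerm hw).hasSum
  have h' : ∑' n, cotTerm (z * Complex.I / Real.pi) n =
      -(Real.pi * Complex.I) * (Complex.cosh z / Complex.sinh z - 1 / z) := by
    have h2 := cot_series_rep' hw
    rw [mul_div_cancel₀ _ hpi, Complex.cot, Complex.cos_mul_I, Complex.sin_mul_I] at h2
    rw [← h2]
    field_simp
    rw [Complex.I_sq]; ring
  rw [h'] at h
  convert! h.mul_left (Complex.I / (2 * Real.pi * z)) using 1
  · ext n
    have hn := hζ n
    have hz1 : z * Complex.I / Real.pi - (n + 1) ≠ 0 := by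
      intro h0
      exact (Complex.mem_integerComplement_iff.1 hw) ⟨n + 1, by push_cast; linear_combination -h0⟩
    have hz2 : z * Complex.I / Real.pi + (n + 1) ≠ 0 := by
      intro h0
      exact (Complex.mem_integerComplement_iff.1 hw) ⟨-(n + 1), by push_cast; linear_combination -h0⟩
    have hp : (z * Complex.I / Real.pi - (n + 1)) * (z * Complex.I / Real.pi + (n + 1)) =
        -((freq n : ℂ) ^ 2 + z ^ 2) / Real.pi ^ 2 := by
      unfold freq; push_cast; field_simp; linear_combination z ^ 2 * Complex.I_sq
    rw [cotTerm, one_div_add_one_div hz1 hz2, hp]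
    field_simp
    ring_nf
    rw [Complex.I_sq]; ring
  · field_simp
    rw [Complex.I_sq]; ring

/-- Since `1 / (f² (f² + z²)) = (1 / f² - 1 / (f² + z²)) / z²`, the sum reduces to
`hasSum_sineMean_sq` and the `coth` series. The odd indices give the same series at `z / 2`, and
`coth z` and `coth (z / 2)` combine to `tanh (z / 2)`. -/
theorem hasSum_sineMean_sq_div {z : ℂ} (hz : z.re ≠ 0)
    (hζ : ∀ n, (freq n : ℂ) ^ 2 + z ^ 2 ≠ 0) :
    HasSum (fun n ↦ (sineMean n : ℂ) ^ 2 / (freq n ^ 2 + z ^ 2))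
      (1 / z ^ 2 * (1 - Complex.tanh (z / 2) / (z / 2))) := by
  have hz0 : z ≠ 0 := by rintro rfl; simp at hz
  have hz2 : (z / 2).re ≠ 0 := by simpa using hz
  have hζ2 : ∀ n, (freq n : ℂ) ^ 2 + (z / 2) ^ 2 ≠ 0 := by
    intro n h
    refine hζ (2 * n + 1) ?_
    rw [freq_two_mul_add_one]; push_cast
    linear_combination 4 * h
  have hA := hasSum_one_div_freq_sq_add_sq hz hζ
  have hB : HasSum (fun k ↦ 1 / ((freq (2 * k + 1) : ℂ) ^ 2 + z ^ 2))
      (1 / 4 * ((Complex.cosh (z / 2) / Complex.sinh (z / 2) - 1 / (z / 2)) / (2 * (z / 2)))) := by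
    convert! (hasSum_one_div_freq_sq_add_sq hz2 hζ2).mul_left (1 / 4) using 1
    ext k
    have h1 := hζ2 k
    have h2 := hζ (2 * k + 1)
    rw [freq_two_mul_add_one] at h2 ⊢
    push_cast at h2 ⊢
    field_simp
    ring
  have hT := (hasSum_sineMean_sq.sub
    ((hasSum_one_sub_neg_one_pow_mul hA hB).mul_left 4)).mul_left (1 / z ^ 2)
  convert! hT using 1
  · ext n
    have hn := hζ n
    have hf := ofReal_freq_ne_zero n
    simp only [sineMean_sq]
    field_simp
    ring
  · have hs := sinh_ne_zero hz2
    have hc := cosh_ne_zero hz2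
    have e1 : Complex.sinh z = 2 * Complex.sinh (z / 2) * Complex.cosh (z / 2) := by
      rw [← Complex.sinh_two_mul]; congr 1; ring
    have e2 : Complex.cosh z = Complex.cosh (z / 2) ^ 2 + Complex.sinh (z / 2) ^ 2 := by
      rw [← Complex.cosh_two_mul]; congr 1; ring
    rw [Complex.tanh_eq_sinh_div_cosh, e1, e2]
    field_simp
    ring

/-! ### Exponential moments and passage to the limit -/

/-- The exponential functional of the first `N` eigenmodes. -/
noncomputable def modeExp (α ζ : ℂ) (N : ℕ) (g : unitInterval → ℝ) : ℂ :=
  Complex.exp (α * (∑ n ∈ Finset.range N, sineCoeff g n * sineMean n : ℝ) -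
    ζ / 2 * (∑ n ∈ Finset.range N, sineCoeff g n ^ 2 : ℝ))

theorem modeExp_eq_prod (α ζ : ℂ) (N : ℕ) (g : unitInterval → ℝ) :
    modeExp α ζ N g = ∏ n : Fin N, Complex.exp (α * sineMean n * sineCoeff g n -
      ζ / 2 * sineCoeff g n ^ 2) := by
  unfold modeExp
  rw [← Complex.exp_sum, Finset.sum_sub_distrib, ← Finset.mul_sum, Finset.sum_range,
    Finset.sum_range]
  push_cast
  rw [Finset.mul_sum]
  congr 2
  exact Finset.sum_congr rfl fun n _ ↦ by ring

theorem IsStandardBridge.aestronglyMeasurable_modeExp (hX : IsStandardBridge X P) (α ζ : ℂ)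
    (N : ℕ) : AEStronglyMeasurable (fun ω ↦ modeExp α ζ N fun s ↦ X s ω) P := by
  have := hX.aemeasurable_sineCoeff
  unfold modeExp
  refine AEMeasurable.aestronglyMeasurable ?_
  fun_prop

theorem IsStandardBridge.integral_modeExp (hX : IsStandardBridge X P) (α : ℂ) {ζ : ℂ}
    (hζ : -Real.pi ^ 2 < ζ.re) (N : ℕ) :
    ∫ ω, modeExp α ζ N (fun s ↦ X s ω) ∂P =
      (∏ n ∈ Finset.range N, modeConst ζ n) *
        Complex.exp (α ^ 2 / 2 * ∑ n ∈ Finset.range N, (sineMean n : ℂ) ^ 2 / (freq n ^ 2 + ζ)) := by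
  simp_rw [modeExp_eq_prod]
  have hm : ∀ n : ℕ, Measurable fun x : ℝ ↦
      Complex.exp (α * sineMean n * x - ζ / 2 * (x : ℂ) ^ 2) := fun n ↦ by fun_prop
  have hind := (hX.iIndepFun_sineCoeff N).comp
    (fun n x ↦ Complex.exp (α * sineMean n * (x : ℂ) - ζ / 2 * (x : ℂ) ^ 2)) fun n ↦ hm n
  have hprod := hind.integral_fun_prod_eq_prod_integral fun n ↦
    ((hm n).comp_aemeasurable (hX.aemeasurable_sineCoeff n)).aestronglyMeasurable
  simp only [Function.comp_apply] at hprod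
  rw [hprod, Finset.mul_sum, Complex.exp_sum, ← Finset.prod_mul_distrib,
    ← Fin.prod_univ_eq_prod_range]
  refine Finset.prod_congr rfl fun n _ ↦ ?_
  rw [← integral_map (hX.aemeasurable_sineCoeff n) (hm n).aestronglyMeasurable,
    hX.map_sineCoeff, integral_cexp_gaussianReal hζ]
  congr 2
  have := freq_sq_add_ne_zero hζ n
  field_simp

/-- For `κ > 0` take `z = i √κ`, with `√κ < π` so that `sinh z ≠ 0`. The truncated expectations are
moduli of mode products, which converge by Euler's product; Fatou's lemma bounds the limit. -/
theorem IsStandardBridge.integrable_exp_integral_sq (hX : IsStandardBridge X P) {κ : ℝ}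
    (hκ : κ < Real.pi ^ 2) : Integrable (fun ω ↦ Real.exp (κ / 2 * ∫ s, X s ω ^ 2)) P := by
  have := hX.isProbabilityMeasure
  have hQ := hX.aemeasurable_integral_sq
  wlog hpos : 0 < κ generalizing κ
  · refine (this (κ := Real.pi ^ 2 / 2) (by nlinarith [Real.pi_pos]) (by positivity)).mono'
      (by fun_prop : AEMeasurable _ P).aestronglyMeasurable (ae_of_all _ fun ω ↦ ?_)
    rw [Real.norm_of_nonneg (Real.exp_pos _).le, Real.exp_le_exp]
    have h0 : 0 ≤ ∫ s, X s ω ^ 2 := integral_nonneg fun _ ↦ sq_nonneg _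
    have h1 : κ ≤ Real.pi ^ 2 / 2 := (not_lt.1 hpos).trans (by positivity)
    exact mul_le_mul_of_nonneg_right (by linarith) h0
  set z : ℂ := (√κ : ℝ) * Complex.I with hzdef
  have hz2 : z ^ 2 = ((-κ : ℝ) : ℂ) := by
    rw [hzdef, mul_pow, Complex.I_sq, ← Complex.ofReal_pow, Real.sq_sqrt hpos.le]
    push_cast; ring
  have hsq : 0 < √κ := Real.sqrt_pos.2 hpos
  have hz0 : z ≠ 0 := mul_ne_zero (by exact_mod_cast hsq.ne') Complex.I_ne_zero
  have hs : Complex.sinh z ≠ 0 := by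
    rw [hzdef, Complex.sinh_mul_I, ← Complex.ofReal_sin]
    have : √κ < Real.pi := by
      rw [← Real.sqrt_sq Real.pi_pos.le]; exact Real.sqrt_lt_sqrt hpos.le hκ
    exact mul_ne_zero (by exact_mod_cast (Real.sin_pos_of_pos_of_lt_pi hsq this).ne')
      Complex.I_ne_zero
  have hre : -Real.pi ^ 2 < (z ^ 2).re := by rw [hz2, Complex.ofReal_re]; linarith
  have hlim := (tendsto_prod_modeConst_sq hz0 hs hre).norm.sqrt
  simp_rw [norm_pow, Real.sqrt_sq (norm_nonneg _)] at hlim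
  have hmode : ∀ N ω, modeExp 0 (z ^ 2) N (fun s ↦ X s ω) =
      (Real.exp (κ / 2 * ∑ n ∈ Finset.range N, sineCoeff (fun s ↦ X s ω) n ^ 2) : ℝ) := by
    intro N ω
    rw [modeExp, hz2, Complex.ofReal_exp]
    congr 1
    push_cast; ring
  have hint : ∀ N, ∫⁻ ω, ENNReal.ofReal
      (Real.exp (κ / 2 * ∑ n ∈ Finset.range N, sineCoeff (fun s ↦ X s ω) n ^ 2)) ∂P =
      ENNReal.ofReal ‖∏ n ∈ Finset.range N, modeConst (z ^ 2) n‖ := by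
    intro N
    have h := hX.integral_modeExp 0 hre N
    simp_rw [hmode] at h
    rw [integral_complex_ofReal] at h
    simp only [ne_eq, OfNat.ofNat_ne_zero, not_false_eq_true, zero_pow, zero_div, zero_mul,
      Complex.exp_zero, mul_one] at h
    -- The integral of a non-integrable function is `0` by convention, so a nonzero value certifies
    -- integrability.
    have hne : ∫ ω, Real.exp (κ / 2 * ∑ n ∈ Finset.range N, sineCoeff (fun s ↦ X s ω) n ^ 2) ∂P
        ≠ 0 := by
      intro h0
      rw [h0] at h
      exact Finset.prod_ne_zero_iff.2 (fun n _ ↦ modeConst_ne_zero hre n) (by simpa using h.symm)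
    rw [← h, Complex.norm_real, Real.norm_of_nonneg (integral_nonneg fun _ ↦ (Real.exp_pos _).le),
      ofReal_integral_eq_lintegral_ofReal (not_imp_comm.1 integral_undef hne)
        (ae_of_all _ fun _ ↦ (Real.exp_pos _).le)]
  refine ⟨(by fun_prop : AEMeasurable _ P).aestronglyMeasurable, ?_⟩
  rw [hasFiniteIntegral_iff_ofReal (ae_of_all _ fun _ ↦ (Real.exp_pos _).le)]
  calc ∫⁻ ω, ENNReal.ofReal (Real.exp (κ / 2 * ∫ s, X s ω ^ 2)) ∂P
      = ∫⁻ ω, liminf (fun N ↦ ENNReal.ofReal (Real.exp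
          (κ / 2 * ∑ n ∈ Finset.range N, sineCoeff (fun s ↦ X s ω) n ^ 2))) atTop ∂P := by
        refine lintegral_congr_ae ?_
        filter_upwards [hX.ae_tendsto_sum_sineCoeff_sq] with ω hω
        have hc : Continuous fun q : ℝ ↦ ENNReal.ofReal (Real.exp (κ / 2 * q)) :=
          ENNReal.continuous_ofReal.comp (by fun_prop)
        exact ((hc.tendsto _).comp hω).liminf_eq.symm
    _ ≤ liminf (fun N ↦ ∫⁻ ω, ENNReal.ofReal (Real.exp
          (κ / 2 * ∑ n ∈ Finset.range N, sineCoeff (fun s ↦ X s ω) n ^ 2)) ∂P) atTop := by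
        refine lintegral_liminf_le' fun N ↦ ?_
        have := hX.aemeasurable_sineCoeff
        fun_prop
    _ = ENNReal.ofReal √‖z / Complex.sinh z‖ := by
        simp_rw [hint]
        exact ((ENNReal.continuous_ofReal.tendsto _).comp hlim).liminf_eq
    _ < ⊤ := ENNReal.ofReal_lt_top

/-- A bound for the exponential functional, uniform over the linear part. -/
theorem norm_cexp_le {α ζ : ℂ} {ε S q Q : ℝ} (hε : 0 < ε) (hS : S ^ 2 ≤ q) (hq : 0 ≤ q)
    (hQ : q ≤ Q) :
    ‖Complex.exp (α * S - ζ / 2 * q)‖ ≤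
      Real.exp (‖α‖ ^ 2 / (2 * ε)) * Real.exp ((max (-ζ.re) 0 + ε) / 2 * Q) := by
  rw [Complex.norm_exp, ← Real.exp_add, Real.exp_le_exp]
  have h1 : (α * S - ζ / 2 * q).re = α.re * S - ζ.re / 2 * q := by
    simp [Complex.sub_re, Complex.mul_re]
  have h2 : α.re * S ≤ ‖α‖ ^ 2 / (2 * ε) + ε / 2 * S ^ 2 := by
    have h3 : α.re ^ 2 ≤ ‖α‖ ^ 2 := sq_le_sq' (by linarith [neg_abs_le α.re, Complex.abs_re_le_norm α])
      ((le_abs_self _).trans (Complex.abs_re_le_norm α))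
    have h4 : α.re * S ≤ α.re ^ 2 / (2 * ε) + ε / 2 * S ^ 2 := by
      have : α.re ^ 2 / (2 * ε) + ε / 2 * S ^ 2 - α.re * S = (α.re - ε * S) ^ 2 / (2 * ε) := by
        field_simp; ring
      have h5 : 0 ≤ (α.re - ε * S) ^ 2 / (2 * ε) := by positivity
      linarith
    have h6 : α.re ^ 2 / (2 * ε) ≤ ‖α‖ ^ 2 / (2 * ε) := by gcongr
    linarith
  have hm0 := le_max_right (-ζ.re) 0
  have hm1 := le_max_left (-ζ.re) 0
  have h7 : -ζ.re / 2 * q ≤ max (-ζ.re) 0 / 2 * Q :=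
    (mul_le_mul_of_nonneg_right (by linarith) hq).trans
      (mul_le_mul_of_nonneg_left hQ (by linarith))
  have h8 : ε / 2 * S ^ 2 ≤ ε / 2 * Q := by gcongr; linarith
  rw [h1]
  nlinarith

/-- The exponential functional of the whole path. -/
noncomputable def pathExp (α ζ : ℂ) (g : unitInterval → ℝ) : ℂ :=
  Complex.exp (α * (∫ s, g s : ℝ) - ζ / 2 * (∫ s, g s ^ 2 : ℝ))

theorem IsStandardBridge.ae_tendsto_modeExp (hX : IsStandardBridge X P) (α ζ : ℂ) :
    ∀ᵐ ω ∂P, Tendsto (fun N ↦ modeExp α ζ N fun s ↦ X s ω) atTop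
      (𝓝 (pathExp α ζ fun s ↦ X s ω)) := by
  filter_upwards [hX.ae_tendsto_sum_sineCoeff_sq, hX.ae_tendsto_sum_sineCoeff_mul_sineMean]
    with ω h1 h2
  have h3 := ((Complex.continuous_ofReal.tendsto _).comp h2).const_mul α
  have h4 := ((Complex.continuous_ofReal.tendsto _).comp h1).const_mul (ζ / 2)
  exact (h3.sub h4).cexp

theorem IsStandardBridge.aestronglyMeasurable_pathExp (hX : IsStandardBridge X P) (α ζ : ℂ) :
    AEStronglyMeasurable (fun ω ↦ pathExp α ζ fun s ↦ X s ω) P := by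
  have h1 := hX.aemeasurable_integral_sq
  have h2 := hX.aemeasurable_integral_path
  unfold pathExp
  refine AEMeasurable.aestronglyMeasurable ?_
  fun_prop

theorem IsStandardBridge.integrable_pathExp (hX : IsStandardBridge X P) (α : ℂ) {ζ : ℂ}
    (hζ : -Real.pi ^ 2 < ζ.re) : Integrable (fun ω ↦ pathExp α ζ fun s ↦ X s ω) P := by
  have hm : max (-ζ.re) 0 < Real.pi ^ 2 := max_lt (by linarith) (by positivity)
  -- Half the gap below `π²` is spent on absorbing the linear term into the quadratic one.
  obtain ⟨ε, hε, hmε⟩ : ∃ ε > 0, max (-ζ.re) 0 + ε < Real.pi ^ 2 :=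
    ⟨(Real.pi ^ 2 - max (-ζ.re) 0) / 2, by linarith, by linarith⟩
  refine ((hX.integrable_exp_integral_sq hmε).const_mul (Real.exp (‖α‖ ^ 2 / (2 * ε)))).mono'
    (hX.aestronglyMeasurable_pathExp α ζ) ?_
  filter_upwards [hX.continuous_paths] with ω hω
  exact norm_cexp_le hε (sq_integral_le hω)
    (integral_nonneg fun _ ↦ sq_nonneg _) le_rfl

/-- The expectation of the exponential functional is the limit over the eigenmodes. -/
theorem IsStandardBridge.tendsto_integral_pathExp (hX : IsStandardBridge X P) (α : ℂ) {ζ : ℂ}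
    (hζ : -Real.pi ^ 2 < ζ.re) :
    Tendsto (fun N ↦ (∏ n ∈ Finset.range N, modeConst ζ n) *
        Complex.exp (α ^ 2 / 2 * ∑ n ∈ Finset.range N, (sineMean n : ℂ) ^ 2 / (freq n ^ 2 + ζ)))
      atTop (𝓝 (∫ ω, pathExp α ζ (fun s ↦ X s ω) ∂P)) := by
  have hm : max (-ζ.re) 0 < Real.pi ^ 2 := max_lt (by linarith) (by positivity)
  obtain ⟨ε, hε, hmε⟩ : ∃ ε > 0, max (-ζ.re) 0 + ε < Real.pi ^ 2 :=
    ⟨(Real.pi ^ 2 - max (-ζ.re) 0) / 2, by linarith, by linarith⟩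
  simp_rw [← hX.integral_modeExp α hζ]
  refine tendsto_integral_of_dominated_convergence _
    (fun N ↦ hX.aestronglyMeasurable_modeExp α ζ N)
    ((hX.integrable_exp_integral_sq hmε).const_mul (Real.exp (‖α‖ ^ 2 / (2 * ε)))) (fun N ↦ ?_)
    (hX.ae_tendsto_modeExp α ζ)
  filter_upwards [hX.continuous_paths] with ω hω
  exact norm_cexp_le hε (sq_sum_mul_sineMean_le N _)
    (Finset.sum_nonneg fun _ _ ↦ sq_nonneg _) (sum_sineCoeff_sq_le hω N)

theorem IsStandardBridge.tendsto_prod_modeConst (hX : IsStandardBridge X P) {ζ : ℂ}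
    (hζ : -Real.pi ^ 2 < ζ.re) :
    Tendsto (fun N ↦ ∏ n ∈ Finset.range N, modeConst ζ n) atTop
      (𝓝 (∫ ω, pathExp 0 ζ (fun s ↦ X s ω) ∂P)) := by
  simpa using hX.tendsto_integral_pathExp 0 hζ

/-- The mode products converge to the expectation at `α = 0`, so the dependence on `α` separates
before that expectation is evaluated. -/
theorem IsStandardBridge.integral_pathExp_eq_mul (hX : IsStandardBridge X P) (α : ℂ) {ζ A : ℂ}
    (hζ : -Real.pi ^ 2 < ζ.re)
    (hA : HasSum (fun n ↦ (sineMean n : ℂ) ^ 2 / (freq n ^ 2 + ζ)) A) :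
    ∫ ω, pathExp α ζ (fun s ↦ X s ω) ∂P =
      (∫ ω, pathExp 0 ζ (fun s ↦ X s ω) ∂P) * Complex.exp (α ^ 2 / 2 * A) :=
  tendsto_nhds_unique (hX.tendsto_integral_pathExp α hζ)
    ((hX.tendsto_prod_modeConst hζ).mul
      ((Complex.continuous_exp.tendsto _).comp (hA.tendsto_sum_nat.const_mul _)))

theorem IsStandardBridge.sq_integral_pathExp (hX : IsStandardBridge X P) {z : ℂ} (hz : z.re ≠ 0)
    (hζ : -Real.pi ^ 2 < (z ^ 2).re) :
    (∫ ω, pathExp 0 (z ^ 2) (fun s ↦ X s ω) ∂P) ^ 2 = z / Complex.sinh z :=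
  tendsto_nhds_unique ((hX.tendsto_prod_modeConst hζ).pow 2)
    (tendsto_prod_modeConst_sq (by rintro rfl; simp at hz) (sinh_ne_zero hz) hζ)

theorem IsStandardBridge.continuousOn_integral_pathExp (hX : IsStandardBridge X P) {m : ℝ}
    (hm : m < Real.pi ^ 2) :
    ContinuousOn (fun ζ ↦ ∫ ω, pathExp 0 ζ (fun s ↦ X s ω) ∂P) {ζ | -m ≤ ζ.re} := by
  refine continuousOn_of_dominated (bound := fun ω ↦ Real.exp (max m 0 / 2 * ∫ s, X s ω ^ 2))
    (fun ζ _ ↦ hX.aestronglyMeasurable_pathExp 0 ζ) (fun ζ hζ ↦ ae_of_all _ fun ω ↦ ?_)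
    (hX.integrable_exp_integral_sq (max_lt hm (by positivity))) (ae_of_all _ fun ω ↦ ?_)
  · have h0 : 0 ≤ ∫ s, X s ω ^ 2 := integral_nonneg fun _ ↦ sq_nonneg _
    rw [pathExp, Complex.norm_exp, Real.exp_le_exp]
    have h1 : (0 * ((∫ s, X s ω : ℝ) : ℂ) - ζ / 2 * (∫ s, X s ω ^ 2 : ℝ)).re =
        -ζ.re / 2 * ∫ s, X s ω ^ 2 := by
      simp [Complex.mul_re]; ring
    rw [h1]
    have h2 : -m ≤ ζ.re := hζ
    exact mul_le_mul_of_nonneg_right (by linarith [le_max_left m 0]) h0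
  · unfold pathExp
    fun_prop

/-! ### The continuous branch of the square root of `z / sinh z` -/

theorem cosh_two_mul_sub_cos_pos {a : ℝ} (ha : 0 < a) (β : ℝ) :
    0 < Real.cosh (2 * a) - Real.cos (2 * β) := by
  have h1 : 1 < Real.cosh (2 * a) := Real.one_lt_cosh.2 (by positivity)
  linarith [Real.cos_le_one (2 * β)]

theorem sinh_mul_sinh_conj (a β : ℝ) :
    2 * (Complex.sinh (a + Complex.I * β) * Complex.sinh (a - Complex.I * β)) =
      ((Real.cosh (2 * a) - Real.cos (2 * β) : ℝ) : ℂ) := by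
  have h1 := Complex.cosh_add (a + Complex.I * β) (a - Complex.I * β)
  have h2 := Complex.cosh_sub (a + Complex.I * β) (a - Complex.I * β)
  rw [show (a : ℂ) + Complex.I * β + (a - Complex.I * β) = 2 * a by ring] at h1
  rw [show (a : ℂ) + Complex.I * β - (a - Complex.I * β) = (2 * β) * Complex.I by ring,
    Complex.cosh_mul_I] at h2
  push_cast
  rw [h1, h2]
  ring

/-- With `sinh_mul_sinh_conj`, this splits `i coth (a + i β)`, the logarithmic derivative of `sinh
(a + i β)` in `β`, into real and imaginary parts: the growth rates of log-modulus and argument. -/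
theorem I_sinh_add_sin (a β : ℝ) :
    Complex.I * Real.sinh (2 * a) + Real.sin (2 * β) =
      2 * Complex.I *
        (Complex.cosh (a + Complex.I * β) * Complex.sinh (a - Complex.I * β)) := by
  have h1 := Complex.sinh_add (a + Complex.I * β) (a - Complex.I * β)
  have h2 := Complex.sinh_sub (a + Complex.I * β) (a - Complex.I * β)
  rw [show (a : ℂ) + Complex.I * β + (a - Complex.I * β) = 2 * a by ring] at h1
  rw [show (a : ℂ) + Complex.I * β - (a - Complex.I * β) = (2 * β) * Complex.I by ring,
    Complex.sinh_mul_I] at h2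
  push_cast
  linear_combination Complex.I * h1 - Complex.I * h2 + Complex.sin (2 * β) * Complex.I_sq

/-- The argument of `sinh (a + i β)`, continued from `β = 0`. -/
noncomputable def argSinh (a β : ℝ) : ℝ :=
  ∫ t in (0 : ℝ)..β, Real.sinh (2 * a) / (Real.cosh (2 * a) - Real.cos (2 * t))

theorem hasDerivAt_argSinh {a : ℝ} (ha : 0 < a) (β : ℝ) :
    HasDerivAt (argSinh a) (Real.sinh (2 * a) / (Real.cosh (2 * a) - Real.cos (2 * β))) β := by
  have hc : Continuous fun t ↦ Real.sinh (2 * a) / (Real.cosh (2 * a) - Real.cos (2 * t)) :=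
    Continuous.div (by fun_prop) (by fun_prop) fun t ↦ (cosh_two_mul_sub_cos_pos ha t).ne'
  exact intervalIntegral.integral_hasDerivAt_right (hc.intervalIntegrable _ _)
    (hc.stronglyMeasurableAtFilter _ _) hc.continuousAt

/-- The polar decomposition of `sinh (a + i β)`. -/
theorem sinh_eq_polar {a : ℝ} (ha : 0 < a) (β : ℝ) :
    Complex.sinh (a + Complex.I * β) =
      (√((Real.cosh (2 * a) - Real.cos (2 * β)) / 2) : ℝ) *
        Complex.exp (Complex.I * argSinh a β) := by
  set w : ℝ → ℝ := fun t ↦ √((Real.cosh (2 * a) - Real.cos (2 * t)) / 2) with hw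
  have hpos := cosh_two_mul_sub_cos_pos ha
  have hwpos : ∀ t, 0 < w t := fun t ↦ Real.sqrt_pos.2 (by have := hpos t; positivity)
  have hwsq : ∀ t, w t ^ 2 = (Real.cosh (2 * a) - Real.cos (2 * t)) / 2 := fun t ↦
    Real.sq_sqrt (by have := hpos t; positivity)
  have hwd : ∀ t, HasDerivAt w (Real.sin (2 * t) / (2 * w t)) t := by
    intro t
    have h1 : HasDerivAt (fun t ↦ (Real.cosh (2 * a) - Real.cos (2 * t)) / 2)
        (Real.sin (2 * t)) t := by
      have := ((((hasDerivAt_id t).const_mul 2).cos).const_sub (Real.cosh (2 * a))).div_const 2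
      convert! this using 1
      simp
    exact h1.sqrt (by have := hpos t; positivity)
  -- The quotient of the two sides has derivative zero and equals `1` at `t = 0`.
  have hF : ∀ t : ℝ, HasDerivAt (fun t : ℝ ↦ Complex.sinh (a + Complex.I * t) *
      Complex.exp (-(Complex.I * argSinh a t)) / (w t : ℂ)) 0 t := by
    intro t
    have h1 : HasDerivAt (fun t : ℝ ↦ Complex.sinh (a + Complex.I * t))
        (Complex.cosh (a + Complex.I * t) * Complex.I) t := by
      have h0 : HasDerivAt (fun t : ℝ ↦ (a : ℂ) + Complex.I * t) Complex.I t := by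
        simpa using ((Complex.ofRealCLM.hasDerivAt (x := t)).const_mul Complex.I).const_add (a : ℂ)
      exact (Complex.hasDerivAt_sinh _).comp t h0
    have h2 := (((hasDerivAt_argSinh ha t).ofReal_comp.const_mul Complex.I).neg).cexp
    have h3 := (hwd t).ofReal_comp
    have hw0 : (w t : ℂ) ≠ 0 := by exact_mod_cast (hwpos t).ne'
    have h4 := (h1.mul h2).div h3 hw0
    refine h4.congr_deriv ?_
    rw [div_eq_zero_iff]
    left
    have hk : ((Real.cosh (2 * a) - Real.cos (2 * t) : ℝ) : ℂ) ≠ 0 := by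
      exact_mod_cast (hpos t).ne'
    have hws : 2 * (w t : ℂ) ^ 2 = ((Real.cosh (2 * a) - Real.cos (2 * t) : ℝ) : ℂ) := by
      rw [← Complex.ofReal_pow, hwsq]; push_cast; ring
    have e1 := sinh_mul_sinh_conj a t
    have e2 := I_sinh_add_sin a t
    rw [← hws] at hk e1
    rw [Complex.ofReal_div, Complex.ofReal_div, ← hws]
    push_cast at e2 ⊢
    simp only [Pi.mul_apply, Pi.neg_apply]
    set S := Complex.sinh (a + Complex.I * t)
    set C := Complex.cosh (a + Complex.I * t)
    set S' := Complex.sinh (a - Complex.I * t)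
    set E := Complex.exp (-(Complex.I * (argSinh a t : ℂ)))
    field_simp
    linear_combination (C * Complex.I * E) * (-e1) - (S * E) * e2
  have hconst := is_const_of_deriv_eq_zero (fun t ↦ (hF t).differentiableAt)
    (fun t ↦ (hF t).deriv) β 0
  have h0 : w 0 = Real.sinh a := by
    have : (Real.cosh (2 * a) - Real.cos (2 * 0)) / 2 = Real.sinh a ^ 2 := by
      rw [Real.cosh_two_mul, Real.cosh_sq]; simp; ring
    rw [hw]
    simp only [this]
    exact Real.sqrt_sq (Real.sinh_nonneg_iff.2 ha.le)
  have ha0 : argSinh a 0 = 0 := by simp [argSinh]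
  have hsa : Complex.sinh (a : ℂ) ≠ 0 := sinh_ne_zero (by simpa using ha.ne')
  rw [ha0, h0] at hconst
  simp only [Complex.ofReal_zero, mul_zero, add_zero, neg_zero, Complex.exp_zero, mul_one,
    Complex.ofReal_sinh, div_self hsa] at hconst
  have hw0 : (w β : ℂ) ≠ 0 := by exact_mod_cast (hwpos β).ne'
  rw [div_eq_one_iff_eq hw0, Complex.exp_neg] at hconst
  have he := Complex.exp_ne_zero (Complex.I * (argSinh a β : ℂ))
  change _ = (w β : ℂ) * _
  rw [← hconst]
  field_simp

theorem eq_polar {a : ℝ} (ha : 0 < a) (β : ℝ) :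
    (a : ℂ) + Complex.I * β =
      (√(a ^ 2 + β ^ 2) : ℝ) * Complex.exp (Complex.I * Real.arctan (β / a)) := by
  have h1 : √(1 + (β / a) ^ 2) = √(a ^ 2 + β ^ 2) / a := by
    rw [show 1 + (β / a) ^ 2 = (a ^ 2 + β ^ 2) / a ^ 2 by field_simp,
      Real.sqrt_div (by positivity), Real.sqrt_sq ha.le]
  have hs : (√(a ^ 2 + β ^ 2) : ℝ) ≠ 0 := (Real.sqrt_pos.2 (by positivity)).ne'
  rw [mul_comm Complex.I ((Real.arctan (β / a) : ℝ) : ℂ), Complex.exp_mul_I,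
    ← Complex.ofReal_cos, ← Complex.ofReal_sin, Real.cos_arctan, Real.sin_arctan, h1]
  have e1 : √(a ^ 2 + β ^ 2) * (1 / (√(a ^ 2 + β ^ 2) / a)) = a := by field_simp
  have e2 : √(a ^ 2 + β ^ 2) * (β / a / (√(a ^ 2 + β ^ 2) / a)) = β := by field_simp
  rw [mul_add, ← mul_assoc, ← Complex.ofReal_mul, ← Complex.ofReal_mul, e1, e2]
  ring

/-- The continuous determination of `√(z / sinh z)` along vertical lines. -/
noncomputable def sqrtDivSinh (a β : ℝ) : ℂ :=
  Complex.exp (Complex.I * ((1 / 2 * Real.arctan (β / a) - 1 / 2 * argSinh a β : ℝ) : ℂ)) *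
    (((2 * (a ^ 2 + β ^ 2) / (Real.cosh (2 * a) - Real.cos (2 * β))) ^ (1 / 4 : ℝ) : ℝ) : ℂ)

theorem sqrtDivSinh_sq {a : ℝ} (ha : 0 < a) (β : ℝ) :
    sqrtDivSinh a β ^ 2 =
      ((a : ℂ) + Complex.I * β) / Complex.sinh ((a : ℂ) + Complex.I * β) := by
  have hpos := cosh_two_mul_sub_cos_pos ha β
  have hr : ((2 * (a ^ 2 + β ^ 2) / (Real.cosh (2 * a) - Real.cos (2 * β))) ^ (1 / 4 : ℝ)) ^ 2 =
      √(a ^ 2 + β ^ 2) / √((Real.cosh (2 * a) - Real.cos (2 * β)) / 2) := by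
    rw [← Real.rpow_natCast, ← Real.rpow_mul (by positivity),
      ← Real.sqrt_div (by positivity), Real.sqrt_eq_rpow]
    congr 1
    · field_simp
    · norm_num
  rw [sinh_eq_polar ha, eq_polar ha, sqrtDivSinh, mul_pow, ← Complex.ofReal_pow, hr,
    ← Complex.exp_nat_mul, mul_div_mul_comm, ← Complex.exp_sub, Complex.ofReal_div, mul_comm]
  congr 2
  push_cast
  ring

theorem sqrtDivSinh_ne_zero {a : ℝ} (ha : 0 < a) (β : ℝ) : sqrtDivSinh a β ≠ 0 := by
  have hpos := cosh_two_mul_sub_cos_pos ha β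
  refine mul_ne_zero (Complex.exp_ne_zero _) ?_
  rw [Complex.ofReal_ne_zero]
  positivity

theorem continuous_sqrtDivSinh {a : ℝ} (ha : 0 < a) : Continuous (sqrtDivSinh a) := by
  have h1 : Continuous (argSinh a) :=
    continuous_iff_continuousAt.2 fun β ↦ (hasDerivAt_argSinh ha β).continuousAt
  have h2 : Continuous fun β ↦
      2 * (a ^ 2 + β ^ 2) / (Real.cosh (2 * a) - Real.cos (2 * β)) :=
    Continuous.div (by fun_prop) (by fun_prop) fun t ↦ (cosh_two_mul_sub_cos_pos ha t).ne'
  have h3 := h2.rpow_const (p := 1 / 4) fun _ ↦ Or.inr (by norm_num)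
  have h4 : Continuous fun β ↦ Real.arctan (β / a) :=
    Real.continuous_arctan.comp (continuous_id.div_const a)
  unfold sqrtDivSinh
  fun_prop

/-! ### Choice of the root: positivity on the real axis, then continuation -/

theorem pathExp_ofReal (α ζ : ℝ) (g : unitInterval → ℝ) :
    pathExp α ζ g = (Real.exp (α * (∫ s, g s) - ζ / 2 * ∫ s, g s ^ 2) : ℝ) := by
  unfold pathExp
  push_cast
  rfl

theorem IsStandardBridge.integral_pathExp_sq (hX : IsStandardBridge X P) {γ : ℝ} (hγ : γ ≠ 0) :
    ∫ ω, pathExp 0 ((γ : ℂ) ^ 2) (fun s ↦ X s ω) ∂P = (√(γ / Real.sinh γ) : ℝ) := by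
  have h : ∀ ω, pathExp 0 ((γ : ℂ) ^ 2) (fun s ↦ X s ω) =
      (Real.exp (0 * (∫ s, X s ω) - γ ^ 2 / 2 * ∫ s, X s ω ^ 2) : ℝ) := fun ω ↦ by
    rw [← pathExp_ofReal]; push_cast; rfl
  have hre : -Real.pi ^ 2 < ((γ : ℂ) ^ 2).re := by
    rw [← Complex.ofReal_pow, Complex.ofReal_re]
    nlinarith [sq_nonneg γ, sq_pos_of_pos Real.pi_pos]
  have hsq := hX.sq_integral_pathExp (z := γ) (by simpa using hγ) hre
  simp_rw [h] at hsq ⊢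
  rw [integral_complex_ofReal] at hsq ⊢
  rw [← Complex.ofReal_sinh, ← Complex.ofReal_pow, ← Complex.ofReal_div, Complex.ofReal_inj] at hsq
  rw [← hsq, Real.sqrt_sq (integral_nonneg fun _ ↦ (Real.exp_pos _).le)]

theorem IsStandardBridge.integral_pathExp_eq_sqrtDivSinh (hX : IsStandardBridge X P) {a b : ℝ}
    (ha : 0 < a) (hb : 0 ≤ b) (hab : -Real.pi ^ 2 < a ^ 2 - b ^ 2) :
    ∫ ω, pathExp 0 (((a : ℂ) + Complex.I * b) ^ 2) (fun s ↦ X s ω) ∂P = sqrtDivSinh a b := by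
  have hre : ∀ β : ℝ, (((a : ℂ) + Complex.I * β) ^ 2).re = a ^ 2 - β ^ 2 := fun β ↦ by
    simp [pow_two]
  have hle : ∀ β ∈ Set.Icc 0 b, a ^ 2 - b ^ 2 ≤ a ^ 2 - β ^ 2 := fun β hβ ↦ by
    have := pow_le_pow_left₀ hβ.1 hβ.2 2
    linarith
  -- On this segment `a ^ 2 - β ^ 2 ≥ a ^ 2 - b ^ 2 > -π²`, so the expectation stays in its domain
  -- of continuity.
  refine (isPreconnected_Icc (a := (0 : ℝ)) (b := b)).eq_of_sq_eq
    (f := fun β : ℝ ↦ ∫ ω, pathExp 0 (((a : ℂ) + Complex.I * β) ^ 2) (fun s ↦ X s ω) ∂P)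
    (g := sqrtDivSinh a) ?_ (continuous_sqrtDivSinh ha).continuousOn ?_
    (fun {β} _ ↦ sqrtDivSinh_ne_zero ha β) (y := 0) ⟨le_rfl, hb⟩ ?_ ⟨hb, le_rfl⟩
  · refine (hX.continuousOn_integral_pathExp (m := -(a ^ 2 - b ^ 2)) (by linarith)).comp
      (f := fun β : ℝ ↦ ((a : ℂ) + Complex.I * β) ^ 2) (by fun_prop) fun β hβ ↦ ?_
    rw [Set.mem_ofPred_eq, hre, neg_neg]
    exact hle β hβ
  · intro β hβ
    simp only [Pi.pow_apply]
    rw [sqrtDivSinh_sq ha, hX.sq_integral_pathExp (by simpa using ha.ne')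
      (by rw [hre]; exact hab.trans_le (hle β hβ))]
  · have h2 := sqrtDivSinh_sq ha 0
    simp only [Complex.ofReal_zero, mul_zero, add_zero] at h2 ⊢
    rw [hX.integral_pathExp_sq ha.ne']
    have h3 : sqrtDivSinh a 0 = (((2 * (a ^ 2 + 0 ^ 2) /
        (Real.cosh (2 * a) - Real.cos (2 * 0))) ^ (1 / 4 : ℝ) : ℝ) : ℂ) := by
      simp [sqrtDivSinh, argSinh]
    have hpos := cosh_two_mul_sub_cos_pos ha 0
    rw [h3, ← Complex.ofReal_sinh, ← Complex.ofReal_pow, ← Complex.ofReal_div,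
      Complex.ofReal_inj] at h2
    rw [h3, ← h2, Real.sqrt_sq (by positivity)]

/-! ### Translation into the variables `χ` and `x` -/

theorem sqrtRe_sq {χ x : ℝ} : sqrtRe χ x ^ 2 = (√(χ ^ 2 + x ^ 2) + χ) / 2 :=
  Real.sq_sqrt (by
    have h1 : |χ| ≤ √(χ ^ 2 + x ^ 2) := Real.abs_le_sqrt (by nlinarith [sq_nonneg x])
    linarith [neg_abs_le χ])

theorem sqrtIm_sq {χ x : ℝ} : sqrtIm χ x ^ 2 = (√(χ ^ 2 + x ^ 2) - χ) / 2 :=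
  Real.sq_sqrt (by
    have h1 : |χ| ≤ √(χ ^ 2 + x ^ 2) := Real.abs_le_sqrt (by nlinarith [sq_nonneg x])
    linarith [le_abs_self χ])

theorem abs_lt_sqrt {χ x : ℝ} (hx : 0 < x) : |χ| < √(χ ^ 2 + x ^ 2) := by
  rw [← Real.sqrt_sq_eq_abs]
  exact Real.sqrt_lt_sqrt (sq_nonneg χ) (by nlinarith)

theorem sqrtRe_pos {χ x : ℝ} (hx : 0 < x) : 0 < sqrtRe χ x :=
  Real.sqrt_pos.2 (by linarith [abs_lt_sqrt (χ := χ) hx, neg_abs_le χ])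

theorem phase_eq {χ x : ℝ} (hx : 0 < x) :
    phase χ x = 1 / 2 * Real.arctan (sqrtIm χ x / sqrtRe χ x) -
      1 / 2 * argSinh (sqrtRe χ x) (sqrtIm χ x) := by
  have hR := abs_lt_sqrt (χ := χ) hx
  have h1 : √(2 * √(χ ^ 2 + x ^ 2) + 2 * χ) = 2 * sqrtRe χ x := by
    rw [Real.sqrt_eq_iff_mul_self_eq_of_pos (by have := sqrtRe_pos (χ := χ) hx; positivity)]
    linear_combination 4 * sqrtRe_sq (χ := χ) (x := x)
  have h2 : √((√(χ ^ 2 + x ^ 2) - χ) / (√(χ ^ 2 + x ^ 2) + χ)) = sqrtIm χ x / sqrtRe χ x := by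
    unfold sqrtIm sqrtRe
    rw [← Real.sqrt_div (by linarith [le_abs_self χ])]
    congr 1
    field_simp
  unfold phase argSinh
  rw [h1, h2, sqrtIm]

theorem amplitude_eq {χ x : ℝ} (hx : 0 < x) :
    amplitude χ x = (2 * (sqrtRe χ x ^ 2 + sqrtIm χ x ^ 2) /
      (Real.cosh (2 * sqrtRe χ x) - Real.cos (2 * sqrtIm χ x))) ^ (1 / 4 : ℝ) := by
  have hR := abs_lt_sqrt (χ := χ) hx
  have h0 : 0 ≤ sqrtIm χ x := Real.sqrt_nonneg _
  have h1 : √(2 * √(χ ^ 2 + x ^ 2) + 2 * χ) = 2 * sqrtRe χ x := by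
    rw [Real.sqrt_eq_iff_mul_self_eq_of_pos (by have := sqrtRe_pos (χ := χ) hx; positivity)]
    linear_combination 4 * sqrtRe_sq (χ := χ) (x := x)
  have h2 : √(2 * √(χ ^ 2 + x ^ 2) - 2 * χ) = 2 * sqrtIm χ x := by
    rw [Real.sqrt_eq_iff_mul_self_eq (by linarith [le_abs_self χ]) (by positivity)]
    linear_combination -4 * sqrtIm_sq (χ := χ) (x := x)
  unfold amplitude
  rw [h1, h2, sqrtRe_sq, sqrtIm_sq]
  congr 2
  ring

theorem sqrtDivSinh_eq {χ x : ℝ} (hx : 0 < x) :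
    sqrtDivSinh (sqrtRe χ x) (sqrtIm χ x) =
      Complex.exp (Complex.I * (phase χ x : ℂ)) * (amplitude χ x : ℂ) := by
  rw [sqrtDivSinh, phase_eq hx, amplitude_eq hx]

/-- Multiply numerator and denominator by `cosh` of the conjugate `v` of `u`: the products become
sums, with `u + v = a` and `u - v = i b`. -/
theorem tanh_half_eq {a : ℝ} (ha : 0 < a) (b : ℝ) :
    Complex.tanh (((a : ℂ) + Complex.I * b) / 2) =
      (Real.sinh a + Complex.I * Real.sin b) / ((Real.cosh a + Real.cos b : ℝ) : ℂ) := by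
  have hc : Complex.cosh (((a : ℂ) + Complex.I * b) / 2) ≠ 0 :=
    cosh_ne_zero (by simpa using ha.ne')
  have hd : ((Real.cosh a + Real.cos b : ℝ) : ℂ) ≠ 0 := by
    rw [Complex.ofReal_ne_zero]
    have := Real.one_lt_cosh.2 ha.ne'
    linarith [Real.neg_one_le_cos b]
  set u := ((a : ℂ) + Complex.I * b) / 2 with hu
  set v := ((a : ℂ) - Complex.I * b) / 2 with hv
  have e1 : u + v = a := by rw [hu, hv]; ring
  have e2 : u - v = b * Complex.I := by rw [hu, hv]; ring
  have h1 := Complex.cosh_add u v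
  have h2 := Complex.cosh_sub u v
  have h3 := Complex.sinh_add u v
  have h4 := Complex.sinh_sub u v
  rw [e1] at h1 h3
  rw [e2] at h2 h4
  rw [Complex.cosh_mul_I] at h2
  rw [Complex.sinh_mul_I] at h4
  rw [Complex.tanh_eq_sinh_div_cosh, div_eq_div_iff hc hd]
  push_cast
  linear_combination Complex.sinh u * (h1 + h2) - Complex.cosh u * (h3 + h4)

theorem fcoef_eq {χ x : ℝ} (hx : 0 < x) (a b : ℝ) (ha : a = sqrtRe χ x) (hb : b = sqrtIm χ x) :
    fcoef χ x =
      1 - ((a * Real.sinh a + b * Real.sin b : ℝ) +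
          Complex.I * (a * Real.sin b - b * Real.sinh a : ℝ)) /
        (((a ^ 2 + b ^ 2) * (Real.cosh a + Real.cos b) / 2 : ℝ) : ℂ) := by
  have hapos : 0 < a := ha ▸ sqrtRe_pos hx
  have hz : (a : ℂ) + Complex.I * b ≠ 0 := by
    intro h
    have := congrArg Complex.re h
    simp at this
    exact hapos.ne' this
  have hd : ((Real.cosh a + Real.cos b : ℝ) : ℂ) ≠ 0 := by
    rw [Complex.ofReal_ne_zero]
    have := Real.one_lt_cosh.2 hapos.ne'
    linarith [Real.neg_one_le_cos b]
  have hab : ((a ^ 2 + b ^ 2 : ℝ) : ℂ) ≠ 0 := by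
    rw [Complex.ofReal_ne_zero]; positivity
  rw [fcoef, csqrt, ← ha, ← hb, tanh_half_eq hapos]
  congr 1
  rw [Complex.ofReal_div, Complex.ofReal_mul, div_div, div_eq_div_iff
    (mul_ne_zero hd (div_ne_zero hz two_ne_zero))
    (div_ne_zero (mul_ne_zero hab hd) (by norm_num))]
  push_cast
  linear_combination (1 / 2 * (Complex.cosh a + Complex.cos b) *
    (b ^ 2 * Complex.sinh a - a * b * Complex.sin b)) * Complex.I_sq

/-! ### The expectation formulas -/

theorem exp_integral_eq_pathExp {g : unitInterval → ℝ} (hg : Continuous g) (α γ : ℝ) :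
    ((Real.exp (∫ s, (α * g s - 1 / 2 * γ ^ 2 * g s ^ 2)) : ℝ) : ℂ) =
      pathExp α ((γ : ℂ) ^ 2) g := by
  rw [integral_sub (continuous_integrable (by fun_prop)) (continuous_integrable (by fun_prop)),
    integral_const_mul, integral_const_mul, pathExp]
  push_cast
  congr 2
  ring

theorem cexp_integral_eq_pathExp {g : unitInterval → ℝ} (hg : Continuous g) (α ζ : ℂ) :
    Complex.exp (∫ s, (α * (g s : ℂ) - ζ / 2 * (g s : ℂ) ^ 2)) = pathExp α ζ g := by
  rw [integral_sub (continuous_integrable (by fun_prop)) (continuous_integrable (by fun_prop)),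
    integral_const_mul, integral_const_mul, pathExp]
  simp_rw [← Complex.ofReal_pow]
  rw [integral_complex_ofReal, integral_complex_ofReal]

theorem neg_pi_sq_lt_re_sq (γ : ℝ) : -Real.pi ^ 2 < ((γ : ℂ) ^ 2).re := by
  rw [← Complex.ofReal_pow, Complex.ofReal_re]
  nlinarith [sq_nonneg γ, sq_pos_of_pos Real.pi_pos]

theorem IsStandardBridge.integrable_exp (hX : IsStandardBridge X P) (α γ : ℝ) :
    Integrable (fun ω ↦ Real.exp (∫ s, (α * X s ω - 1 / 2 * γ ^ 2 * X s ω ^ 2))) P := by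
  have h := (hX.integrable_pathExp α (neg_pi_sq_lt_re_sq γ)).re
  refine h.congr ?_
  filter_upwards [hX.continuous_paths] with ω hω
  rw [← exp_integral_eq_pathExp hω]
  exact Complex.ofReal_re _

theorem IsStandardBridge.ofReal_integral_exp (hX : IsStandardBridge X P) (α γ : ℝ) :
    ((∫ ω, Real.exp (∫ s, (α * X s ω - 1 / 2 * γ ^ 2 * X s ω ^ 2)) ∂P : ℝ) : ℂ) =
      ∫ ω, pathExp α ((γ : ℂ) ^ 2) (fun s ↦ X s ω) ∂P := by
  rw [← integral_complex_ofReal]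
  refine integral_congr_ae ?_
  filter_upwards [hX.continuous_paths] with ω hω
  exact exp_integral_eq_pathExp hω α γ

theorem IsStandardBridge.integral_exp (hX : IsStandardBridge X P) (α : ℝ) {γ : ℝ} (hγ : γ ≠ 0) :
    ∫ ω, Real.exp (∫ s, (α * X s ω - 1 / 2 * γ ^ 2 * X s ω ^ 2)) ∂P =
      √(γ / Real.sinh γ) * Real.exp (α ^ 2 / γ ^ 3 * (γ / 2 - Real.tanh (γ / 2))) := by
  rw [← Complex.ofReal_inj, hX.ofReal_integral_exp,
    hX.integral_pathExp_eq_mul _ (neg_pi_sq_lt_re_sq γ)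
      (hasSum_sineMean_sq_div (z := γ) (by simpa using hγ)
        (freq_sq_add_ne_zero (neg_pi_sq_lt_re_sq γ))), hX.integral_pathExp_sq hγ]
  have hγ' : (γ : ℂ) ≠ 0 := by exact_mod_cast hγ
  push_cast
  congr 2
  field_simp

theorem IsStandardBridge.integral_exp_linear (hX : IsStandardBridge X P) (α : ℝ) :
    ∫ ω, Real.exp (∫ s, α * X s ω) ∂P = Real.exp (α ^ 2 / 24) := by
  have := hX.isProbabilityMeasure
  have h := hX.ofReal_integral_exp α 0
  have hre : -Real.pi ^ 2 < (0 : ℂ).re := by simp [Real.pi_pos]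
  simp only [Complex.ofReal_zero, ne_eq, OfNat.ofNat_ne_zero, not_false_eq_true, zero_pow,
    mul_zero, zero_mul, sub_zero] at h
  rw [hX.integral_pathExp_eq_mul _ hre hasSum_sineMean_sq_div_freq_sq] at h
  rw [← Complex.ofReal_inj, h]
  simp only [pathExp, zero_mul, zero_div, sub_self, Complex.exp_zero, integral_const,
    probReal_univ, one_smul, one_mul]
  push_cast
  congr 1
  ring

theorem IsStandardBridge.integral_cexp (hX : IsStandardBridge X P) (ξ : ℝ) {χ x : ℝ}
    (hχ : -Real.pi ^ 2 < χ) (hx : 0 < x) :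
    Integrable (fun ω ↦ Complex.exp (∫ s, (Complex.I * (ξ : ℂ) * (X s ω : ℂ) -
        ((χ : ℂ) + Complex.I * (x : ℂ)) / 2 * (X s ω : ℂ) ^ 2))) P ∧
    ∫ ω, Complex.exp (∫ s, (Complex.I * (ξ : ℂ) * (X s ω : ℂ) -
        ((χ : ℂ) + Complex.I * (x : ℂ)) / 2 * (X s ω : ℂ) ^ 2)) ∂P =
      Complex.exp (Complex.I * (phase χ x : ℂ)) * (amplitude χ x : ℂ) *
        Complex.exp ((-(ξ : ℂ) ^ 2 / 2) / ((χ : ℂ) + Complex.I * (x : ℂ)) * fcoef χ x) := by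
  have hre : -Real.pi ^ 2 < ((χ : ℂ) + Complex.I * (x : ℂ)).re := by simpa using hχ
  have hae : (fun ω ↦ Complex.exp (∫ s, (Complex.I * (ξ : ℂ) * (X s ω : ℂ) -
      ((χ : ℂ) + Complex.I * (x : ℂ)) / 2 * (X s ω : ℂ) ^ 2))) =ᵐ[P]
      fun ω ↦ pathExp (Complex.I * ξ) ((χ : ℂ) + Complex.I * x) (fun s ↦ X s ω) := by
    filter_upwards [hX.continuous_paths] with ω hω
    exact cexp_integral_eq_pathExp hω _ _
  refine ⟨(hX.integrable_pathExp _ hre).congr hae.symm, ?_⟩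
  rw [integral_congr_ae hae]
  have hz := csqrt_sq χ x hx.le
  have hapos := sqrtRe_pos (χ := χ) hx
  have hb0 : 0 ≤ sqrtIm χ x := Real.sqrt_nonneg _
  have hG := hX.integral_pathExp_eq_sqrtDivSinh hapos hb0
    (by rw [sqrtRe_sq, sqrtIm_sq]; linarith)
  have hzre : (csqrt χ x).re ≠ 0 := by simpa [csqrt] using hapos.ne'
  rw [← hz] at hre ⊢
  rw [hX.integral_pathExp_eq_mul _ hre (hasSum_sineMean_sq_div hzre (freq_sq_add_ne_zero hre)),
    ← sqrtDivSinh_eq hx, ← hG, fcoef]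
  change _ * _ = _ * _
  congr 2
  rw [mul_pow, Complex.I_sq]
  ring

end BrownianBridge

theorem corollary6p2 {Ω : Type*} [MeasurableSpace Ω] (P : Measure Ω)
    (X : unitInterval → Ω → ℝ) (hX : BrownianBridge.IsStandardBridge X P) :
    -- the functional is integrable for all real constants, `0` included
    (∀ α γ : ℝ,
      Integrable (fun ω ↦ Real.exp (∫ s, (α * X s ω - 1 / 2 * γ ^ 2 * X s ω ^ 2))) P) ∧
    -- its expectation for `γ ≠ 0`
    (∀ α γ : ℝ, γ ≠ 0 →
      ∫ ω, Real.exp (∫ s, (α * X s ω - 1 / 2 * γ ^ 2 * X s ω ^ 2)) ∂P =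
        √(γ / Real.sinh γ) * Real.exp (α ^ 2 / γ ^ 3 * (γ / 2 - Real.tanh (γ / 2)))) ∧
    -- its expectation for `γ = 0`, where the right side above is read as its limit
    (∀ α : ℝ, ∫ ω, Real.exp (∫ s, α * X s ω) ∂P = Real.exp (α ^ 2 / 24)) ∧
    -- the analytic continuation to the complex quadratic coefficient `χ + i x`
    (∀ ξ χ x : ℝ, -Real.pi ^ 2 < χ → 0 < x →
      Integrable (fun ω ↦ Complex.exp (∫ s, (Complex.I * (ξ : ℂ) * (X s ω : ℂ) -
          ((χ : ℂ) + Complex.I * (x : ℂ)) / 2 * (X s ω : ℂ) ^ 2))) P ∧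
      ∫ ω, Complex.exp (∫ s, (Complex.I * (ξ : ℂ) * (X s ω : ℂ) -
          ((χ : ℂ) + Complex.I * (x : ℂ)) / 2 * (X s ω : ℂ) ^ 2)) ∂P =
        Complex.exp (Complex.I * (BrownianBridge.phase χ x : ℂ)) *
          (BrownianBridge.amplitude χ x : ℂ) *
          Complex.exp ((-(ξ : ℂ) ^ 2 / 2) / ((χ : ℂ) + Complex.I * (x : ℂ)) *
            BrownianBridge.fcoef χ x) ∧
      -- the expression of `f(χ, x)` through `√(χ + i x) = a + i b`
      ∀ a b : ℝ, a = BrownianBridge.sqrtRe χ x → b = BrownianBridge.sqrtIm χ x →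
        BrownianBridge.fcoef χ x =
          1 - ((a * Real.sinh a + b * Real.sin b : ℝ) +
              Complex.I * (a * Real.sin b - b * Real.sinh a : ℝ)) /
            (((a ^ 2 + b ^ 2) * (Real.cosh a + Real.cos b) / 2 : ℝ) : ℂ)) :=
  ⟨hX.integrable_exp, fun α _ hγ ↦ hX.integral_exp α hγ, hX.integral_exp_linear,
    fun ξ _ _ hχ hx ↦ ⟨(hX.integral_cexp ξ hχ hx).1, (hX.integral_cexp ξ hχ hx).2,
      BrownianBridge.fcoef_eq hx⟩⟩
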